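/- Let $\Bbbk$ be a field of characteristic $0$, $A$ an associative unital $\Bbbk$-algebra, and let $(U,A)$, $(V,A)$ be left Hopf algebroids over $A$, i.e. left bialgebroids with source $s$, target $t$, coproduct $\Delta(u)=u_{(1)}\otimes_A u_{(2)}\in U_\triangleleft\otimes_A{}_\triangleright U$ (relations $t(a)x\otimes y=x\otimes s(a)y$) and counit $\varepsilon$, such that the map $u\otimes v\mapsto u_{(1)}\otimes_A u_{(2)}v$ from $U\otimes_{A^{op}}U$ (relations $x\,t(a)\otimes y=x\otimes t(a)y$) to $U_\triangleleft\otimes_A{}_\triangleright U$ is bijective; write $u_+\otimes_{A^{op}}u_-$ for the preimage of $u\otimes_A 1$. Let $\pi\colon U\to V$ be a surjective morphism of left Hopf algebroids and let $\gamma\colon V\to U$ be a morphism of $A$-corings with $\pi\circ\gamma=\mathrm{id}_V$ such that, for all $v\in V$, $a\in A$, $$\gamma(1_V)=1_U,\qquad \gamma(v\,t_V(a))=\gamma(v)\,t_U(a),\qquad \gamma(v\,s_V(a))=\gamma(v)\,s_U(a).$$ Assume that $U_\triangleleft$, i.e. $U$ with the right $A$-action $u\triangleleft a=t_U(a)u$,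 is a projective right $A$-module. Let $$B=\{u\in U\mid u_{(1)}\otimes_A\pi(u_{(2)})=u\otimes_A 1_V\}$$ be the left Hopf kernel of $\pi$, an $A$-ring (a $\Bbbk$-subalgebra of $U$) with unit map $s_U\colon A\to B$. Then: (1) The formula $v\rightharpoonup b=\gamma(v)_+\,b\,\gamma(v)_-$ is a weak left $V$-action on $B$, that is, it is $\Bbbk$-bilinear with values in $B$ and satisfies $(s(a)t(a')v)\rightharpoonup b=s_U(a)(v\rightharpoonup b)s_U(a')$, $v\rightharpoonup 1=s_U(\varepsilon(v))$, $v\rightharpoonup(bb')=(v_{(1)}\rightharpoonup b)(v_{(2)}\rightharpoonup b')$ and $1\rightharpoonup b=b$. (2) The formula $$\sigma(v,w)=t_U\varepsilon_U\big(\gamma(v_{(2)}w_{(2)})_+\big)\,\gamma(v_{(1)})\gamma(w_{(1)})\,\gamma(v_{(2)}w_{(2)})_-$$ gives a well-defined $\Bbbk$-linear map $\sigma\colon V\otimes_{A^{op}}V\to B$. Here an expression $t_U\varepsilon_U(y)\,x\,z$ attached to an element of $U_\triangleleft\otimes_A({}_\triangleright U\otimes_{A^{op}}U)$ is evaluated on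 its (unique) preimage in $(U\times_AU)\otimes_{A^{op}}U$, where $U\times_AU=\{\sum x_i\otimes y_i\in U_\triangleleft\otimes_A{}_\triangleright U\mid \sum x_it(a)\otimes y_i=\sum x_i\otimes y_is(a)\ \forall a\in A\}$. The map $\sigma$ is a $B$-valued Hopf $2$-cocycle: $\sigma(s(a)t(a')v,w)=s_U(a)\sigma(v,w)s_U(a')$, $(u_{(1)}\rightharpoonup s_U(a))\,\sigma(u_{(2)},v)=\sigma(u,s(a)v)$, $\sigma(1,u)=s_U(\varepsilon(u))=\sigma(u,1)$, and $$\big(u_{(1)}\rightharpoonup\sigma(v_{(1)},w_{(1)})\big)\,\sigma(u_{(2)},v_{(2)}w_{(2)})=\sigma(u_{(1)},v_{(1)})\,\sigma(u_{(2)}v_{(2)},w).$$ Moreover $B$ is a $\sigma$-twisted left $V$-module: $\big(u_{(1)}\rightharpoonup(v_{(1)}\rightharpoonup b)\big)\sigma(u_{(2)},v_{(2)})=\sigma(u_{(1)},v_{(1)})\,(u_{(2)}v_{(2)}\rightharpoonup b)$. (3) Let $B\#_\sigma V$ be the crossed product, i.e. $B\otimes_AV$ (relations $b\,s_U(a)\otimes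 v=b\otimes s_V(a)v$, with $b\# v$ the class of $b\otimes v$) with unit $1\#1$ and the well-defined associative multiplication $(b\# v)(b'\# w)=b\,(v_{(1)}\rightharpoonup b')\,\sigma(v_{(2)},w_{(1)})\,\#\,v_{(3)}w_{(2)}$. It is an $A\otimes A^{op}$-ring via $a\otimes a'\mapsto s_U(a)\# t_V(a')$ and a right $V$-comodule algebra via $b\# v\mapsto(b\# v_{(1)})\otimes_Av_{(2)}$, and $$\Phi\colon B\#_\sigma V\to U,\qquad b\# v\mapsto b\,\gamma(v)$$ is an isomorphism of $A\otimes A^{op}$-rings (with $a\otimes a'\mapsto s_U(a)t_U(a')$ on $U$) and of right $V$-comodule algebras (with coaction $u\mapsto u_{(1)}\otimes_A\pi(u_{(2)})$ on $U$). Its inverse is $$\Psi(u)=t_U\varepsilon_U\big(\gamma(\pi(u_{(2)}))_+\big)\,u_{(1)}\,\gamma(\pi(u_{(2)}))_-\ \#\ \pi(u_{(3)}),$$ where the expression in front of $\#$ is evaluated in the sense of (2) and lies in $B$. -/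

import Mathlib

open scoped TensorProduct
open MulOpposite (op)

noncomputable section

namespace Bialgd

section Balanced

variable {k A : Type*} [CommRing k]
variable {M N M' N' : Type*} [AddCommGroup M] [Module k M] [AddCommGroup N] [Module k N]
  [AddCommGroup M'] [Module k M'] [AddCommGroup N'] [Module k N']

/-- The relations `r a m ⊗ n = m ⊗ l a n` in `M ⊗ N`. -/
def balRel (r : A → Module.End k M) (l : A → Module.End k N) : Submodule k (M ⊗[k] N) :=
  Submodule.span k {z | ∃ (a : A) (m : M) (n : N), z = r a m ⊗ₜ[k] n - m ⊗ₜ[k] l a n}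

/-- The tensor product over the (noncommutative) `k`-algebra `A` of a right `A`-module `M`, with
action `m ◁ a = r a m`, and a left `A`-module `N`, with action `a ▹ n = l a n`. -/
def BalTensor (r : A → Module.End k M) (l : A → Module.End k N) :=
  (M ⊗[k] N) ⧸ balRel r l

instance (r : A → Module.End k M) (l : A → Module.End k N) :
    AddCommGroup (BalTensor r l) :=
  inferInstanceAs (AddCommGroup ((M ⊗[k] N) ⧸ balRel r l))

instance (r : A → Module.End k M) (l : A → Module.End k N) :
    Module k (BalTensor r l) :=
  inferInstanceAs (Module k ((M ⊗[k] N) ⧸ balRel r l))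

/-- The quotient map `M ⊗ N → M ⊗_A N`. -/
def BalTensor.mkQ (r : A → Module.End k M) (l : A → Module.End k N) :
    M ⊗[k] N →ₗ[k] BalTensor r l :=
  (balRel r l).mkQ

/-- The class `m ⊗_A n` of a pure tensor. -/
def BalTensor.tmul {r : A → Module.End k M} {l : A → Module.End k N} (m : M) (n : N) :
    BalTensor r l :=
  BalTensor.mkQ r l (m ⊗ₜ[k] n)

infixl:70 " ⊗ᵇ " => BalTensor.tmul

/-- The map `f ⊗_A g` for maps compatible with the actions. -/
def BalTensor.map {r : A → Module.End k M} {l : A → Module.End k N}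
    {r' : A → Module.End k M'} {l' : A → Module.End k N'}
    (f : M →ₗ[k] M') (g : N →ₗ[k] N')
    (hf : ∀ a m, f (r a m) = r' a (f m)) (hg : ∀ a n, g (l a n) = l' a (g n)) :
    BalTensor r l →ₗ[k] BalTensor r' l' :=
  Submodule.mapQ _ _ (TensorProduct.map f g) (by
    refine Submodule.span_le.2 ?_
    rintro _ ⟨a, m, n, rfl⟩
    refine Submodule.subset_span ⟨a, f m, g n, ?_⟩
    simp [hf, hg])

theorem BalTensor.map_tmul {r : A → Module.End k M} {l : A → Module.End k N}
    {r' : A → Module.End k M'} {l' : A → Module.End k N'}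
    (f : M →ₗ[k] M') (g : N →ₗ[k] N')
    (hf : ∀ a m, f (r a m) = r' a (f m)) (hg : ∀ a n, g (l a n) = l' a (g n)) (m : M) (n : N) :
    BalTensor.map f g hf hg (m ⊗ᵇ n : BalTensor r l) = (f m ⊗ᵇ g n : BalTensor r' l') := rfl

/-- The map induced by a balanced bilinear map. -/
def BalTensor.lift {r : A → Module.End k M} {l : A → Module.End k N} (f : M →ₗ[k] N →ₗ[k] M')
    (hf : ∀ a m n, f (r a m) n = f m (l a n)) : BalTensor r l →ₗ[k] M' :=
  (balRel r l).liftQ (TensorProduct.lift f) (by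
    refine Submodule.span_le.2 ?_
    rintro _ ⟨a, m, n, rfl⟩
    simp [hf])

theorem BalTensor.lift_tmul {r : A → Module.End k M} {l : A → Module.End k N}
    (f : M →ₗ[k] N →ₗ[k] M') (hf : ∀ a m n, f (r a m) n = f m (l a n)) (m : M) (n : N) :
    BalTensor.lift f hf (m ⊗ᵇ n : BalTensor r l) = f m n := rfl

theorem BalTensor.exists_rep {r : A → Module.End k M} {l : A → Module.End k N}
    (X : BalTensor r l) :
    ∃ (n : ℕ) (x : Fin n → M) (y : Fin n → N), X = ∑ i, x i ⊗ᵇ y i := by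
  obtain ⟨X, rfl⟩ := (balRel r l).mkQ_surjective X
  change ∃ (n : ℕ) (x : Fin n → M) (y : Fin n → N), BalTensor.mkQ r l X = ∑ i, x i ⊗ᵇ y i
  obtain ⟨n, x, y, rfl⟩ := TensorProduct.exists_sum_tmul_eq X
  exact ⟨n, x, y, by simp [BalTensor.tmul]⟩

end Balanced

section EnvRing

variable {k A R U V : Type*} [CommRing k] [Ring A] [Algebra k A] [Ring R] [Algebra k R]
  [Ring U] [Algebra k U] [Ring V] [Algebra k V]

/-- The tensor product `R_◁ ⊗_A ▹V`, with relations `t(a) x ⊗ y = x ⊗ s(a) y`. -/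
abbrev WTensor (t : Aᵐᵒᵖ →ₐ[k] R) (s : A →ₐ[k] V) :=
  BalTensor (fun a : A => LinearMap.mulLeft k (t (op a))) (fun a : A => LinearMap.mulLeft k (s a))

/-- `x ⊗ y ↦ x t(a) ⊗ y` on `R_◁ ⊗_A ▹V`. -/
def blackLeft (t : Aᵐᵒᵖ →ₐ[k] R) (s : A →ₐ[k] V) (a : A) : Module.End k (WTensor t s) :=
  BalTensor.map (LinearMap.mulRight k (t (op a))) LinearMap.id
    (fun b m => by simp [mul_assoc]) (fun _ _ => rfl)

/-- `x ⊗ y ↦ x ⊗ y s(a)` on `R_◁ ⊗_A ▹V`. -/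
def blackRight (t : Aᵐᵒᵖ →ₐ[k] R) (s : A →ₐ[k] V) (a : A) : Module.End k (WTensor t s) :=
  BalTensor.map LinearMap.id (LinearMap.mulRight k (s a))
    (fun _ _ => rfl) (fun b m => by simp [mul_assoc])

/-- Membership in the Sweedler-Takeuchi product `R ×_A V ⊆ R_◁ ⊗_A ▹V`:
`∑ xᵢ t(a) ⊗ yᵢ = ∑ xᵢ ⊗ yᵢ s(a)` for all `a`. -/
def IsTakeuchi {t : Aᵐᵒᵖ →ₐ[k] R} {s : A →ₐ[k] V} (X : WTensor t s) : Prop :=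
  ∀ a : A, blackLeft t s a X = blackRight t s a X

variable (k A U) in
/-- An `A ⊗ Aᵒᵖ`-ring: source `s`, an algebra map, and target `t`, an algebra antihomomorphism,
with commuting images (equivalently, an algebra map `a ⊗ a' ↦ s(a) t(a')`). -/
structure EnvRing where
  s : A →ₐ[k] U
  t : Aᵐᵒᵖ →ₐ[k] U
  comm : ∀ a b : A, s a * t (op b) = t (op b) * s a

namespace EnvRing

variable (E : EnvRing k A U)

/-- `U_◁ ⊗_A ▹U`. -/
abbrev Tensor := WTensor E.t E.s

/-- The left action `a ▹ (x ⊗ y) = s(a) x ⊗ y` on `U_◁ ⊗_A ▹U`. -/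
def leftS (a : A) : Module.End k E.Tensor :=
  BalTensor.map (LinearMap.mulLeft k (E.s a)) LinearMap.id
    (fun b m => by simp [← mul_assoc, E.comm]) (fun _ _ => rfl)

/-- `R_◁ ⊗_A ▹U_◁ ⊗_A ▹U`, bracketed to the right. -/
abbrev Tensor3 (t : Aᵐᵒᵖ →ₐ[k] R) :=
  BalTensor (fun a : A => LinearMap.mulLeft k (t (op a))) E.leftS

/-- `▶U ⊗_{Aᵒᵖ} U_◁`, with relations `x t(a) ⊗ y = x ⊗ t(a) y`. -/
abbrev OpTensor :=
  BalTensor (fun a : A => LinearMap.mulRight k (E.t (op a)))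
    (fun a : A => LinearMap.mulLeft k (E.t (op a)))

/-- The left action `a ▹ (x ⊗ y) = s(a) x ⊗ y` on `▶U ⊗_{Aᵒᵖ} U_◁`. -/
def opLeftS (a : A) : Module.End k E.OpTensor :=
  BalTensor.map (LinearMap.mulLeft k (E.s a)) LinearMap.id
    (fun b m => by simp [mul_assoc]) (fun _ _ => rfl)

/-- `U_◁ ⊗_A (▹▶U ⊗_{Aᵒᵖ} U_◁)`. -/
abbrev MixedTensor :=
  BalTensor (fun a : A => LinearMap.mulLeft k (E.t (op a))) E.opLeftS

/-- `U_◁`, the right `A`-module `U` with `u ◁ a = t(a) u`, is projective. -/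
def WhiteRightProjective : Prop :=
  @Module.Projective Aᵐᵒᵖ _ U _ (Module.compHom U (E.t : Aᵐᵒᵖ →+* U))

end EnvRing

end EnvRing

section Bialgebroid

variable {k A R U V B : Type*} [CommRing k] [Ring A] [Algebra k A] [Ring R] [Algebra k R]
  [Ring U] [Algebra k U] [Ring V] [Algebra k V] [Ring B] [Algebra k B]

variable (k A U) in
/-- A left bialgebroid `(U, A, Δ, ε, s, t)`.

Here and below an equation in Sweedler notation is required for all finite families
representing the coproducts in it: `comul u = ∑ i, x i ⊗ᵇ y i` stands for `u₍₁₎ ⊗_A u₍₂₎`. -/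
structure LeftBialgebroid extends EnvRing k A U where
  counit : U →ₗ[k] A
  counit_white : ∀ (b c : A) (u : U), counit (s b * t (op c) * u) = b * counit u * c
  counit_black : ∀ (a : A) (u : U), counit (u * t (op a)) = counit (u * s a)
  counit_mul : ∀ u v : U, counit (u * v) = counit (u * s (counit v))
  counit_one : counit 1 = 1
  comul : U →ₗ[k] toEnvRing.Tensor
  comul_takeuchi : ∀ u, IsTakeuchi (comul u)
  comul_actions : ∀ (a b c d : A) (u : U) {n : ℕ} (x y : Fin n → U),
    comul u = ∑ i, x i ⊗ᵇ y i →
    comul (t (op c) * s b * u * s d * t (op a)) =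
      ∑ i, (s b * x i * s d) ⊗ᵇ (t (op c) * y i * t (op a))
  comul_mul : ∀ (u v : U) {n m : ℕ} (x y : Fin n → U) (x' y' : Fin m → U),
    comul u = ∑ i, x i ⊗ᵇ y i → comul v = ∑ j, x' j ⊗ᵇ y' j →
    comul (u * v) = ∑ i, ∑ j, (x i * x' j) ⊗ᵇ (y i * y' j)
  comul_one : comul 1 = 1 ⊗ᵇ 1
  counit_comul : ∀ (u : U) {n : ℕ} (x y : Fin n → U), comul u = ∑ i, x i ⊗ᵇ y i →
    ∑ i, s (counit (x i)) * y i = u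
  comul_counit : ∀ (u : U) {n : ℕ} (x y : Fin n → U), comul u = ∑ i, x i ⊗ᵇ y i →
    ∑ i, t (op (counit (y i))) * x i = u
  coassoc : ∀ (u : U) {n m : ℕ} (x y : Fin n → U) (x' x'' : Fin n → Fin m → U),
    comul u = ∑ i, x i ⊗ᵇ y i → (∀ i, comul (x i) = ∑ j, x' i j ⊗ᵇ x'' i j) →
    (∑ i, ∑ j, x' i j ⊗ᵇ (x'' i j ⊗ᵇ y i) : toEnvRing.Tensor3 t) = ∑ i, x i ⊗ᵇ comul (y i)

variable (k A U) in
/-- A left Hopf algebroid: a left bialgebroid whose Hopf-Galois map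
`▶U ⊗_{Aᵒᵖ} U_◁ → U_◁ ⊗_A ▹U`, `u ⊗ v ↦ u₍₁₎ ⊗ u₍₂₎ v`, is invertible. -/
structure LeftHopfAlgebroid extends LeftBialgebroid k A U where
  galois : toEnvRing.OpTensor ≃ₗ[k] toEnvRing.Tensor
  galois_tmul : ∀ (u v : U) {n : ℕ} (x y : Fin n → U), comul u = ∑ i, x i ⊗ᵇ y i →
    galois (u ⊗ᵇ v) = ∑ i, x i ⊗ᵇ (y i * v)

/-- The translation map `u ↦ u₊ ⊗_{Aᵒᵖ} u₋`, the preimage of `u ⊗_A 1` under the Hopf-Galois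
map. -/
def LeftHopfAlgebroid.translation (𝒰 : LeftHopfAlgebroid k A U) (u : U) : 𝒰.OpTensor :=
  𝒰.galois.symm (u ⊗ᵇ 1)

/-- A morphism of left Hopf algebroids over the same base. -/
structure LeftHopfAlgebroid.Hom (𝒰 : LeftHopfAlgebroid k A U) (𝒱 : LeftHopfAlgebroid k A V) where
  hom : U →ₐ[k] V
  hom_s : ∀ a, hom (𝒰.s a) = 𝒱.s a
  hom_t : ∀ a, hom (𝒰.t a) = 𝒱.t a
  counit_hom : ∀ u, 𝒱.counit (hom u) = 𝒰.counit u
  comul_hom : ∀ u, 𝒱.comul (hom u) =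
    BalTensor.map hom.toLinearMap hom.toLinearMap
      (fun a m => by simp [hom_t]) (fun a m => by simp [hom_s]) (𝒰.comul u)
  translation_hom : ∀ u, 𝒱.translation (hom u) =
    BalTensor.map hom.toLinearMap hom.toLinearMap
      (fun a m => by simp [hom_t]) (fun a m => by simp [hom_t]) (𝒰.translation u)

/-- A morphism of the `A`-corings underlying two left bialgebroids. -/
structure CoringHom (𝒱 : LeftBialgebroid k A V) (𝒰 : LeftBialgebroid k A U) where
  hom : V →ₗ[k] U
  hom_s : ∀ a v, hom (𝒱.s a * v) = 𝒰.s a * hom v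
  hom_t : ∀ a v, hom (𝒱.t a * v) = 𝒰.t a * hom v
  counit_hom : ∀ v, 𝒰.counit (hom v) = 𝒱.counit v
  comul_hom : ∀ v, 𝒰.comul (hom v) =
    BalTensor.map hom hom (fun a m => hom_t (op a) m) (fun a m => hom_s a m) (𝒱.comul v)

/-- A right comodule algebra over the left bialgebroid `𝒱`: an `Aᵒᵖ`-ring `t : Aᵒᵖ → R`, with
`r ◁ a = t(a) r` and `a ▶ r = r t(a)`, and a coaction `R → R ×_A V ⊆ R_◁ ⊗_A ▹V` that is right
`A`-linear, coassociative, counital, multiplicative and unital. -/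
structure IsRightComoduleAlgebra (𝒱 : LeftBialgebroid k A V) (t : Aᵐᵒᵖ →ₐ[k] R)
    (δ : R →ₗ[k] WTensor t 𝒱.s) : Prop where
  takeuchi : ∀ r, IsTakeuchi (δ r)
  right_linear : ∀ (a : A) (r : R) {n : ℕ} (x : Fin n → R) (y : Fin n → V),
    δ r = ∑ i, x i ⊗ᵇ y i → δ (t (op a) * r) = ∑ i, x i ⊗ᵇ (𝒱.t (op a) * y i)
  coassoc : ∀ (r : R) {n m : ℕ} (x : Fin n → R) (y : Fin n → V)
    (x' : Fin n → Fin m → R) (x'' : Fin n → Fin m → V),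
    δ r = ∑ i, x i ⊗ᵇ y i → (∀ i, δ (x i) = ∑ j, x' i j ⊗ᵇ x'' i j) →
    (∑ i, ∑ j, x' i j ⊗ᵇ (x'' i j ⊗ᵇ y i) : 𝒱.Tensor3 t) = ∑ i, x i ⊗ᵇ 𝒱.comul (y i)
  counital : ∀ (r : R) {n : ℕ} (x : Fin n → R) (y : Fin n → V),
    δ r = ∑ i, x i ⊗ᵇ y i → ∑ i, t (op (𝒱.counit (y i))) * x i = r
  mul : ∀ (r r' : R) {n m : ℕ} (x : Fin n → R) (y : Fin n → V) (x' : Fin m → R) (y' : Fin m → V),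
    δ r = ∑ i, x i ⊗ᵇ y i → δ r' = ∑ j, x' j ⊗ᵇ y' j →
    δ (r * r') = ∑ i, ∑ j, (x i * x' j) ⊗ᵇ (y i * y' j)
  one : δ 1 = 1 ⊗ᵇ 1

/-! ### Measurings, cocycles, twisted modules, crossed products -/

/-- A measuring of the `A`-ring `ι : A → B` by the left bialgebroid `𝒱`. -/
structure Measuring (𝒱 : LeftBialgebroid k A V) (ι : A →ₐ[k] B) where
  act : V →ₗ[k] B →ₗ[k] B
  act_white : ∀ (a a' : A) (v : V) (b : B),
    act (𝒱.s a * 𝒱.t (op a') * v) b = ι a * act v b * ι a'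
  act_one : ∀ v, act v 1 = ι (𝒱.counit v)
  act_mul : ∀ (v : V) (b b' : B) {n : ℕ} (x y : Fin n → V), 𝒱.comul v = ∑ i, x i ⊗ᵇ y i →
    act v (b * b') = ∑ i, act (x i) b * act (y i) b'

variable {𝒱 : LeftBialgebroid k A V} {ι : A →ₐ[k] B}

/-- A `B`-valued Hopf 2-cocycle `σ : ▶V ⊗_{Aᵒᵖ} V_◁ → B`; `σ(v, w)` is `σ (v ⊗ᵇ w)`. -/
structure IsCocycle (M : Measuring 𝒱 ι) (σ : 𝒱.OpTensor →ₗ[k] B) : Prop where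
  white : ∀ (a a' : A) (v w : V),
    σ ((𝒱.s a * 𝒱.t (op a') * v) ⊗ᵇ w) = ι a * σ (v ⊗ᵇ w) * ι a'
  act_unit : ∀ (a : A) (u v : V) {n : ℕ} (x y : Fin n → V), 𝒱.comul u = ∑ i, x i ⊗ᵇ y i →
    ∑ i, M.act (x i) (ι a) * σ (y i ⊗ᵇ v) = σ (u ⊗ᵇ (𝒱.s a * v))
  one_left : ∀ u, σ (1 ⊗ᵇ u) = ι (𝒱.counit u)
  one_right : ∀ u, σ (u ⊗ᵇ 1) = ι (𝒱.counit u)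
  cocycle : ∀ (u v w : V) {n m l : ℕ} (x y : Fin n → V) (x' y' : Fin m → V) (x'' y'' : Fin l → V),
    𝒱.comul u = ∑ i, x i ⊗ᵇ y i → 𝒱.comul v = ∑ j, x' j ⊗ᵇ y' j →
    𝒱.comul w = ∑ h, x'' h ⊗ᵇ y'' h →
    ∑ i, ∑ j, ∑ h, M.act (x i) (σ (x' j ⊗ᵇ x'' h)) * σ (y i ⊗ᵇ (y' j * y'' h)) =
      ∑ i, ∑ j, σ (x i ⊗ᵇ x' j) * σ ((y i * y' j) ⊗ᵇ w)

/-- `B` is a `σ`-twisted left `𝒱`-module: `σ` is a 2-cocycle, the measuring is a weak action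
(`1 ▷ b = b`), and the twisted associativity holds. -/
structure IsTwistedModule (M : Measuring 𝒱 ι) (σ : 𝒱.OpTensor →ₗ[k] B) : Prop
    extends IsCocycle M σ where
  one_act : ∀ b, M.act 1 b = b
  twisted : ∀ (u v : V) (b : B) {n m : ℕ} (x y : Fin n → V) (x' y' : Fin m → V),
    𝒱.comul u = ∑ i, x i ⊗ᵇ y i → 𝒱.comul v = ∑ j, x' j ⊗ᵇ y' j →
    ∑ i, ∑ j, M.act (x i) (M.act (x' j) b) * σ (y i ⊗ᵇ y' j) =
      ∑ i, ∑ j, σ (x i ⊗ᵇ x' j) * M.act (y i * y' j) b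

/-- `B_▸ ⊗_A ▹V`, with relations `b ι(a) ⊗ v = b ⊗ s(a) v`. -/
abbrev BTensor (𝒱 : LeftBialgebroid k A V) (ι : A →ₐ[k] B) :=
  BalTensor (fun a : A => LinearMap.mulRight k (ι a)) (fun a : A => LinearMap.mulLeft k (𝒱.s a))

/-- The crossed product structure on `B_▸ ⊗_A ▹V`: the associative bilinear multiplication with
unit `1 ⊗ 1` and `(b ⊗ v)(b' ⊗ w) = b (v₍₁₎ ▷ b') σ(v₍₂₎, w₍₁₎) ⊗ v₍₃₎ w₍₂₎`. The formula
determines `mul`, so there is at most one such structure. -/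
structure CrossedProduct (M : Measuring 𝒱 ι) (σ : 𝒱.OpTensor →ₗ[k] B) where
  mul : BTensor 𝒱 ι →ₗ[k] BTensor 𝒱 ι →ₗ[k] BTensor 𝒱 ι
  mul_tmul : ∀ (b b' : B) (v w : V) {n m l : ℕ} (v₁ v₂₃ : Fin n → V) (v₂ v₃ : Fin n → Fin m → V)
    (w₁ w₂ : Fin l → V),
    𝒱.comul v = ∑ i, v₁ i ⊗ᵇ v₂₃ i → (∀ i, 𝒱.comul (v₂₃ i) = ∑ j, v₂ i j ⊗ᵇ v₃ i j) →
    𝒱.comul w = ∑ h, w₁ h ⊗ᵇ w₂ h →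
    mul (b ⊗ᵇ v) (b' ⊗ᵇ w) =
      ∑ i, ∑ j, ∑ h, (b * M.act (v₁ i) b' * σ (v₂ i j ⊗ᵇ w₁ h)) ⊗ᵇ (v₃ i j * w₂ h)
  mul_assoc : ∀ x y z, mul (mul x y) z = mul x (mul y z)
  one_mul : ∀ x, mul (1 ⊗ᵇ 1) x = x
  mul_one : ∀ x, mul x (1 ⊗ᵇ 1) = x

namespace CrossedProduct

variable {M : Measuring 𝒱 ι} {σ : 𝒱.OpTensor →ₗ[k] B}

/-- The underlying set `B_▸ ⊗_A ▹V` of the algebra `B #_σ V`. -/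
def Carrier (_ : CrossedProduct M σ) := BTensor 𝒱 ι

variable (C : CrossedProduct M σ)

instance : AddCommGroup C.Carrier := inferInstanceAs (AddCommGroup (BTensor 𝒱 ι))

instance : Module k C.Carrier := inferInstanceAs (Module k (BTensor 𝒱 ι))

instance : Ring C.Carrier where
  __ := (inferInstance : AddCommGroup C.Carrier)
  mul x y := C.mul x y
  one := (1 ⊗ᵇ 1 : BTensor 𝒱 ι)
  mul_assoc := C.mul_assoc
  one_mul := C.one_mul
  mul_one := C.mul_one
  zero_mul x := LinearMap.map_zero₂ C.mul x
  mul_zero x := (C.mul x).map_zero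
  left_distrib x y z := (C.mul x).map_add y z
  right_distrib x y z := by
    change C.mul (x + y) z = C.mul x z + C.mul y z
    exact LinearMap.map_add₂ C.mul x y z

instance : Algebra k C.Carrier :=
  Algebra.ofModule (fun c x y => LinearMap.map_smul₂ C.mul c x y)
    (fun c x y => (C.mul x).map_smul c y)

/-- The element `b # v` of `B #_σ V`. -/
def tmul (b : B) (v : V) : C.Carrier := (b ⊗ᵇ v : BTensor 𝒱 ι)

end CrossedProduct

/-! ### The left Hopf kernel -/

namespace LeftHopfAlgebroid

variable {𝒰 : LeftHopfAlgebroid k A U} {𝒱 : LeftHopfAlgebroid k A V}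

/-- The map `U ⊗_A π : U_◁ ⊗_A ▹U → U_◁ ⊗_A ▹V`. -/
def Hom.idTensor (π : 𝒰.Hom 𝒱) : 𝒰.Tensor →ₗ[k] WTensor 𝒰.t 𝒱.s :=
  BalTensor.map LinearMap.id π.hom.toLinearMap (fun _ _ => rfl) (fun a m => by simp [π.hom_s])

theorem Hom.idTensor_tmul (π : 𝒰.Hom 𝒱) (x y : U) :
    π.idTensor (x ⊗ᵇ y) = x ⊗ᵇ π.hom y := rfl

/-- The coaction `(U ⊗_A π) Δ : U → U_◁ ⊗_A ▹V`. -/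
def Hom.coaction (π : 𝒰.Hom 𝒱) : U →ₗ[k] WTensor 𝒰.t 𝒱.s :=
  π.idTensor ∘ₗ 𝒰.comul

theorem Hom.coaction_eq (π : 𝒰.Hom 𝒱) {u : U} {n : ℕ} {x y : Fin n → U}
    (h : 𝒰.comul u = ∑ i, x i ⊗ᵇ y i) : π.coaction u = ∑ i, x i ⊗ᵇ π.hom (y i) := by
  simp only [Hom.coaction, LinearMap.comp_apply, h, map_sum, Hom.idTensor_tmul]

theorem Hom.mul_t_of_coaction (π : 𝒰.Hom 𝒱) {b : U} (hb : π.coaction b = b ⊗ᵇ 1) (a : A) :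
    b * 𝒰.t (op a) = 𝒰.t (op a) * b := by
  obtain ⟨n, x, y, h⟩ := BalTensor.exists_rep (𝒰.comul b)
  have h1 := 𝒰.comul_actions a 1 1 1 b x y h
  simp only [MulOpposite.op_one, map_one, one_mul, mul_one] at h1
  have h2 := 𝒰.comul_counit _ _ _ h1
  let f : U →ₗ[k] V →ₗ[k] U :=
    LinearMap.mk₂ k (fun x v => 𝒰.t (op (𝒱.counit (v * 𝒱.t (op a)))) * x)
      (fun _ _ _ => mul_add _ _ _) (fun _ _ _ => mul_smul_comm _ _ _)
      (fun _ _ _ => by simp [add_mul]) (fun _ _ _ => by simp)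
  have hf : ∀ (c : A) (x : U) (v : V),
      f (LinearMap.mulLeft k (𝒰.t (op c)) x) v = f x (LinearMap.mulLeft k (𝒱.s c) v) := by
    intro c x v
    have := 𝒱.counit_white c 1 (v * 𝒱.t (op a))
    simp only [MulOpposite.op_one, map_one, mul_one] at this
    simp [f, mul_assoc, this]
  have h3 := congrArg (BalTensor.lift f hf) hb
  rw [π.coaction_eq h, map_sum] at h3
  simp only [BalTensor.lift_tmul] at h3
  have h4 := 𝒱.counit_white 1 a 1
  simp only [map_one, one_mul, mul_one, 𝒱.counit_one] at h4
  have h5 : ∀ v : U, 𝒱.counit (π.hom v * 𝒱.t (op a)) = 𝒰.counit (v * 𝒰.t (op a)) := by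
    intro v
    rw [← π.hom_t, ← map_mul, π.counit_hom]
  simp only [f, LinearMap.mk₂_apply, h5, one_mul, h4] at h3
  rw [← h2, h3]

/-- The left Hopf kernel `B = {u | (U ⊗_A π) Δ u = u ⊗_A 1}`, a subalgebra of `U`. -/
def Hom.kernel (π : 𝒰.Hom 𝒱) : Subalgebra k U where
  carrier := {u | π.coaction u = u ⊗ᵇ 1}
  mul_mem' := by
    intro b b' hb hb'
    obtain ⟨n, x, y, h⟩ := BalTensor.exists_rep (𝒰.comul b)
    obtain ⟨m, x', y', h'⟩ := BalTensor.exists_rep (𝒰.comul b')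
    have ht := π.mul_t_of_coaction hb
    have key : ∀ j, (∑ i, (x i * x' j) ⊗ᵇ (π.hom (y i) * π.hom (y' j)) : WTensor 𝒰.t 𝒱.s) =
        (b * x' j) ⊗ᵇ π.hom (y' j) := by
      intro j
      let F : Module.End k (WTensor 𝒰.t 𝒱.s) := BalTensor.map (LinearMap.mulRight k (x' j))
        (LinearMap.mulRight k (π.hom (y' j)))
        (fun a m => by simp [mul_assoc]) (fun a m => by simp [mul_assoc])
      have hF : ∀ x v, F (x ⊗ᵇ v) = (x * x' j) ⊗ᵇ (v * π.hom (y' j)) := fun _ _ => rfl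
      have := congrArg F ((π.coaction_eq h).symm.trans hb)
      simpa only [map_sum, hF, one_mul] using this
    let G : Module.End k (WTensor 𝒰.t 𝒱.s) := BalTensor.map (LinearMap.mulLeft k b) LinearMap.id
      (fun a m => by simp [← mul_assoc, ht]) (fun a m => rfl)
    have hG : ∀ x v, G (x ⊗ᵇ v) = (b * x) ⊗ᵇ v := fun _ _ => rfl
    have key2 := congrArg G ((π.coaction_eq h').symm.trans hb')
    simp only [map_sum, hG] at key2
    change π.coaction (b * b') = (b * b') ⊗ᵇ 1
    rw [← key2, Hom.coaction, LinearMap.comp_apply, 𝒰.comul_mul b b' x y x' y' h h',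
      Finset.sum_comm]
    simp only [map_sum, Hom.idTensor_tmul, ← key, map_mul]
  add_mem' := by
    intro b b' hb hb'
    change π.coaction (b + b') = (b + b') ⊗ᵇ 1
    rw [map_add, hb, hb']
    simp [BalTensor.tmul, TensorProduct.add_tmul]
  algebraMap_mem' := by
    intro c
    change π.coaction _ = _ ⊗ᵇ 1
    rw [Algebra.algebraMap_eq_smul_one, map_smul, Hom.coaction, LinearMap.comp_apply, 𝒰.comul_one,
      Hom.idTensor_tmul]
    simp [BalTensor.tmul, ← TensorProduct.smul_tmul']

/-- The `A`-ring structure `s : A → B` of the left Hopf kernel. -/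
def Hom.kernelUnit (π : 𝒰.Hom 𝒱) : A →ₐ[k] π.kernel :=
  𝒰.s.codRestrict π.kernel (by
    intro a
    change π.coaction (𝒰.s a) = 𝒰.s a ⊗ᵇ 1
    have h := 𝒰.comul_actions 1 a 1 1 1 (fun _ : Fin 1 => 1) (fun _ => 1) (by simp [𝒰.comul_one])
    simp only [MulOpposite.op_one, map_one, one_mul, mul_one] at h
    rw [π.coaction_eq h]
    simp)

/-- `𝒰.Contracts X c`: the element `X` of `U_◁ ⊗_A (▹▶U ⊗_{Aᵒᵖ} U_◁)` comes from an element
`∑ⱼ (∑ᵢ xᵢⱼ ⊗ yᵢⱼ) ⊗ zⱼ` of `(U ×_A U) ⊗_{Aᵒᵖ} U_◁`, and `c = ∑ t(ε(yᵢⱼ)) xᵢⱼ zⱼ`. The expression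
`t(ε(y)) x z` is balanced only on `(U ×_A U) ⊗_{Aᵒᵖ} U_◁`; this is the meaning of formulas such as
`t(ε(u₍₂₎₊)) u₍₁₎ u₍₂₎₋`. -/
def Contracts (𝒰 : LeftHopfAlgebroid k A U) (X : 𝒰.MixedTensor) (c : U) : Prop :=
  ∃ (m n : ℕ) (x y : Fin m → Fin n → U) (z : Fin n → U),
    (∀ j, IsTakeuchi (∑ i, x i j ⊗ᵇ y i j : 𝒰.Tensor)) ∧
    X = ∑ j, ∑ i, x i j ⊗ᵇ (y i j ⊗ᵇ z j) ∧
    c = ∑ j, ∑ i, 𝒰.t (op (𝒰.counit (y i j))) * x i j * z j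

end LeftHopfAlgebroid

end Bialgebroid

end Bialgd

end

open Bialgd

/-! Everything is governed by one map, the retraction φ(u) = t(ε(γ(π(u₍₂₎))₊)) u₍₁₎ γ(π(u₍₂₎))₋. It
plays the role of u₍₁₎ γ⁻¹(π(u₍₂₎)) for a cleft extension of Hopf algebras, the translation map
replacing the missing convolution inverse of γ.

The expression t(ε(y)) x z is not balanced on the whole triple tensor product. Projectivity of `U_◁`
repairs this: a dual basis writes z = ∑ t(fₑ(z)) e, and moving t(fₑ(z)) to y gives a linear map
`contraction` defined everywhere. It agrees with the naive formula on (U ×_A U) ⊗ U. Conversely, the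
coordinates of an element invariant under exchanging x t(a) with y s(a) lie in U ×_A U, so that such
an element has a lift (`contracts_iff`).

From u₍₁₎ ⊗ u₍₂₎₊ ⊗ u₍₂₎₋ = u₊₍₁₎ ⊗ u₊₍₂₎ ⊗ u₋ and the inverse of the Hopf-Galois map β one obtains
φ(u₍₁₎) γ(π(u₍₂₎)) = u, φ(γ(v) b) = γ(v)₊ b γ(v)₋ and φ(γ(v)) = s(ε(v)). A factor γ(π(u₍₂₎)) can
moreover be cancelled (`eq_zero_of_sum_mul_section`). Comparing the coaction of φ(u) with φ(u) ⊗ 1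
and cancelling shows that φ has values in the kernel B (`retraction_mem`).

Hence b ⊗ v ↦ b γ(v) is a bijection B ⊗_A V → U with inverse u ↦ φ(u₍₁₎) ⊗ π(u₍₂₎). With v ▷ b =
φ(γ(v) b) and σ(v, w) = φ(γ(v) γ(w)), the reconstruction formula reads γ(v) b = (v₍₁₎ ▷ b) γ(v₍₂₎)
and γ(v) γ(w) = σ(v₍₁₎, w₍₁₎) γ(v₍₂₎ w₍₂₎). As φ is left B-linear, the cocycle and twisted module
identities, and associativity of the crossed product, are associativity in U. -/

noncomputable section

namespace Bialgd

/-! ### Balanced tensor products -/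

namespace BalTensor

section Basic

variable {k A : Type*} [CommRing k]
variable {M N P : Type*} [AddCommGroup M] [Module k M] [AddCommGroup N] [Module k N]
  [AddCommGroup P] [Module k P]
variable {r : A → Module.End k M} {l : A → Module.End k N}

/-- The bilinear map `(m, n) ↦ m ⊗_A n`. -/
def mk (r : A → Module.End k M) (l : A → Module.End k N) : M →ₗ[k] N →ₗ[k] BalTensor r l :=
  (TensorProduct.mk k M N).compr₂ (mkQ r l)

theorem add_tmul (m m' : M) (n : N) :
    ((m + m') ⊗ᵇ n : BalTensor r l) = m ⊗ᵇ n + m' ⊗ᵇ n := LinearMap.map_add₂ (mk r l) m m' n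

theorem tmul_add (m : M) (n n' : N) :
    (m ⊗ᵇ (n + n') : BalTensor r l) = m ⊗ᵇ n + m ⊗ᵇ n' := map_add (mk r l m) n n'

theorem zero_tmul (n : N) : (0 ⊗ᵇ n : BalTensor r l) = 0 := LinearMap.map_zero₂ (mk r l) n

theorem smul_tmul (c : k) (m : M) (n : N) :
    ((c • m) ⊗ᵇ n : BalTensor r l) = c • (m ⊗ᵇ n) := LinearMap.map_smul₂ (mk r l) c m n

theorem tmul_smul (c : k) (m : M) (n : N) :
    (m ⊗ᵇ (c • n) : BalTensor r l) = c • (m ⊗ᵇ n) := map_smul (mk r l m) c n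

theorem sum_tmul {ι : Type*} (S : Finset ι) (m : ι → M) (n : N) :
    ((∑ i ∈ S, m i) ⊗ᵇ n : BalTensor r l) = ∑ i ∈ S, m i ⊗ᵇ n :=
  LinearMap.map_sum₂ (mk r l) S m n

theorem tmul_sum {ι : Type*} (S : Finset ι) (m : M) (n : ι → N) :
    (m ⊗ᵇ (∑ i ∈ S, n i) : BalTensor r l) = ∑ i ∈ S, m ⊗ᵇ n i :=
  map_sum (mk r l m) n S

theorem act_tmul (a : A) (m : M) (n : N) :
    (r a m ⊗ᵇ n : BalTensor r l) = m ⊗ᵇ l a n :=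
  (Submodule.Quotient.eq _).2 (Submodule.subset_span ⟨a, m, n, rfl⟩)

theorem ext {f g : BalTensor r l →ₗ[k] P} (h : ∀ m n, f (m ⊗ᵇ n) = g (m ⊗ᵇ n)) : f = g := by
  ext X
  obtain ⟨n, x, y, rfl⟩ := exists_rep X
  simp only [map_sum, h]

theorem induction_on {p : BalTensor r l → Prop} (X : BalTensor r l) (h0 : p 0)
    (ht : ∀ m n, p (m ⊗ᵇ n)) (ha : ∀ X Y, p X → p Y → p (X + Y)) : p X := by
  obtain ⟨n, x, y, rfl⟩ := exists_rep X
  exact Finset.sum_induction _ p ha h0 fun i _ => ht _ _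

/-- Finitely many elements have representations of the same length. -/
theorem exists_rep_family {n : ℕ} (X : Fin n → BalTensor r l) :
    ∃ (m : ℕ) (x : Fin n → Fin m → M) (y : Fin n → Fin m → N),
      ∀ i, X i = ∑ j, x i j ⊗ᵇ y i j := by
  choose m x y h using fun i => exists_rep (X i)
  -- The common length is the sum of all lengths; the i-th representation is padded by zeros outside
  -- its own block.
  let e := Fintype.equivFin (Σ i, Fin (m i))
  refine ⟨_, fun i j => if (e.symm j).1 = i then x _ (e.symm j).2 else 0,
    fun i j => y _ (e.symm j).2, fun i => ?_⟩
  rw [e.symm.sum_comp (fun p : Σ i, Fin (m i) =>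
    ((if p.1 = i then x _ p.2 else 0) ⊗ᵇ y _ p.2 : BalTensor r l)), Fintype.sum_sigma,
    Finset.sum_eq_single i]
  · simp [h i]
  · intro i' _ hi
    simp [hi, zero_tmul]
  · simp

theorem exists_rep_nested {Q : Type*} [AddCommGroup Q] [Module k Q] {C : Type*}
    {r' : C → Module.End k P} {l' : C → Module.End k Q}
    {l : A → Module.End k (BalTensor r' l')} (X : BalTensor r l) :
    ∃ (n : ℕ) (x : Fin n → M) (y : Fin n → P) (z : Fin n → Q),
      X = ∑ i, x i ⊗ᵇ (y i ⊗ᵇ z i) := by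
  obtain ⟨n, x, Y, rfl⟩ := exists_rep X
  obtain ⟨m, y, z, h⟩ := exists_rep_family Y
  let e := finProdFinEquiv (m := n) (n := m)
  refine ⟨n * m, fun i => x (e.symm i).1, fun i => y (e.symm i).1 (e.symm i).2,
    fun i => z (e.symm i).1 (e.symm i).2, ?_⟩
  rw [e.symm.sum_comp (fun p : Fin n × Fin m =>
    (x p.1 ⊗ᵇ (y p.1 p.2 ⊗ᵇ z p.1 p.2) : BalTensor r l)), Fintype.sum_prod_type]
  simp only [h, tmul_sum]

end Basic

section Map

variable {k A : Type*} [CommRing k]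
variable {M N M' N' : Type*} [AddCommGroup M] [Module k M] [AddCommGroup N] [Module k N]
  [AddCommGroup M'] [Module k M'] [AddCommGroup N'] [Module k N']

/-- Both factors are required to be bijective, so that the inverses induce a left inverse and no
flatness enters. It serves to cancel id ⊗ β. -/
theorem map_injective {r : A → Module.End k M} {l : A → Module.End k N}
    {r' : A → Module.End k M'} {l' : A → Module.End k N'}
    (f : M ≃ₗ[k] M') (g : N ≃ₗ[k] N') (hf : ∀ a m, f (r a m) = r' a (f m))
    (hg : ∀ a n, g (l a n) = l' a (g n)) :
    Function.Injective (map (f : M →ₗ[k] M') (g : N →ₗ[k] N') hf hg) := by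
  refine Function.LeftInverse.injective (g := map (f.symm : M' →ₗ[k] M) (g.symm : N' →ₗ[k] N)
    (fun a m => f.injective (by simp [hf])) (fun a m => g.injective (by simp [hg]))) fun X => ?_
  obtain ⟨n, x, y, rfl⟩ := exists_rep X
  simp [map_tmul]

end Map

end BalTensor

/-! ### Operators on the tensor products over an A ⊗ Aᵒᵖ-ring -/

section Env

variable {k A R U V : Type*} [CommRing k] [Ring A] [Algebra k A] [Ring R] [Algebra k R]
  [Ring U] [Algebra k U] [Ring V] [Algebra k V]

theorem WTensor.t_mul_tmul {t : Aᵐᵒᵖ →ₐ[k] R} {s : A →ₐ[k] V} (a : A) (x : R) (y : V) :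
    ((t (op a) * x) ⊗ᵇ y : WTensor t s) = x ⊗ᵇ (s a * y) :=
  BalTensor.act_tmul (r := fun a : A => LinearMap.mulLeft k (t (op a)))
    (l := fun a : A => LinearMap.mulLeft k (s a)) a x y

theorem blackLeft_tmul (t : Aᵐᵒᵖ →ₐ[k] R) (s : A →ₐ[k] V) (a : A) (x : R) (y : V) :
    blackLeft t s a (x ⊗ᵇ y) = (x * t (op a)) ⊗ᵇ y := rfl

theorem blackRight_tmul (t : Aᵐᵒᵖ →ₐ[k] R) (s : A →ₐ[k] V) (a : A) (x : R) (y : V) :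
    blackRight t s a (x ⊗ᵇ y) = x ⊗ᵇ (y * s a) := rfl

namespace EnvRing

variable (E : EnvRing k A U)

theorem OpTensor.mul_t_tmul (a : A) (x y : U) :
    ((x * E.t (op a)) ⊗ᵇ y : E.OpTensor) = x ⊗ᵇ (E.t (op a) * y) :=
  BalTensor.act_tmul (r := fun a : A => LinearMap.mulRight k (E.t (op a)))
    (l := fun a : A => LinearMap.mulLeft k (E.t (op a))) a x y

/-- `R_◁ ⊗_A (▹▶U ⊗_{Aᵒᵖ} U_◁)`. -/
abbrev MixedOver (t : Aᵐᵒᵖ →ₐ[k] R) :=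
  BalTensor (fun a : A => LinearMap.mulLeft k (t (op a))) E.opLeftS

/-- `x ⊗ y ↦ x ⊗ y z` on `▶U ⊗_{Aᵒᵖ} U_◁`. -/
def opMulRight (z : U) : Module.End k E.OpTensor :=
  BalTensor.map LinearMap.id (LinearMap.mulRight k z) (fun _ _ => rfl)
    (fun a m => by simp [mul_assoc])

theorem opMulRight_tmul (z x y : U) : E.opMulRight z (x ⊗ᵇ y) = x ⊗ᵇ (y * z) := rfl

/-- `x ⊗ y ↦ x s(a) ⊗ y` on `▶U ⊗_{Aᵒᵖ} U_◁`. -/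
def opMulS (a : A) : Module.End k E.OpTensor :=
  BalTensor.map (LinearMap.mulRight k (E.s a)) LinearMap.id
    (fun b m => by simp [mul_assoc, E.comm]) (fun _ _ => rfl)

theorem opMulS_tmul (a : A) (x y : U) : E.opMulS a (x ⊗ᵇ y) = (x * E.s a) ⊗ᵇ y := rfl

/-- `x ⊗ y ↦ t(a) x ⊗ y` on `▶U ⊗_{Aᵒᵖ} U_◁`. -/
def opTMul (a : A) : Module.End k E.OpTensor :=
  BalTensor.map (LinearMap.mulLeft k (E.t (op a))) LinearMap.id
    (fun b m => by simp [mul_assoc]) (fun _ _ => rfl)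

theorem opTMul_tmul (a : A) (x y : U) : E.opTMul a (x ⊗ᵇ y) = (E.t (op a) * x) ⊗ᵇ y := rfl

theorem opLeftS_tmul (a : A) (x y : U) : E.opLeftS a (x ⊗ᵇ y) = (E.s a * x) ⊗ᵇ y := rfl

theorem leftS_tmul (a : A) (x y : U) : E.leftS a (x ⊗ᵇ y) = (E.s a * x) ⊗ᵇ y := rfl

/-- `x ⊗ y ↦ x ⊗ (y ⊗ z)`. -/
def insertRight (t : Aᵐᵒᵖ →ₐ[k] R) (z : U) : WTensor t E.s →ₗ[k] E.MixedOver t :=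
  BalTensor.map LinearMap.id ((BalTensor.mk _ _).flip z) (fun _ _ => rfl) (fun _ _ => rfl)

theorem insertRight_tmul (t : Aᵐᵒᵖ →ₐ[k] R) (x : R) (y z : U) :
    E.insertRight t z (x ⊗ᵇ y) = x ⊗ᵇ (y ⊗ᵇ z) := rfl

/-- `x ⊗ y ↦ x ⊗ (y ⊗ z)`. -/
def insertRight₃ (t : Aᵐᵒᵖ →ₐ[k] R) (z : U) : WTensor t E.s →ₗ[k] E.Tensor3 t :=
  BalTensor.map LinearMap.id ((BalTensor.mk _ _).flip z) (fun _ _ => rfl) (fun _ _ => rfl)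

theorem insertRight₃_tmul (t : Aᵐᵒᵖ →ₐ[k] R) (x : R) (y z : U) :
    E.insertRight₃ t z (x ⊗ᵇ y) = x ⊗ᵇ (y ⊗ᵇ z) := rfl

/-- `x ⊗ y ↦ x ⊗ y z` on `U_◁ ⊗_A ▹U`. -/
def mulRightSnd (z : U) : Module.End k E.Tensor :=
  BalTensor.map LinearMap.id (LinearMap.mulRight k z) (fun _ _ => rfl)
    (fun a m => by simp [mul_assoc])

theorem mulRightSnd_tmul (z x y : U) : E.mulRightSnd z (x ⊗ᵇ y) = x ⊗ᵇ (y * z) := rfl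

theorem mulRightSnd_leftS (z : U) (a : A) (X : E.Tensor) :
    E.mulRightSnd z (E.leftS a X) = E.leftS a (E.mulRightSnd z X) := by
  induction X using BalTensor.induction_on with
  | h0 => simp
  | ht x y => rfl
  | ha X Y hX hY => simp [hX, hY]

theorem opMulRight_opLeftS (z : U) (a : A) (X : E.OpTensor) :
    E.opMulRight z (E.opLeftS a X) = E.opLeftS a (E.opMulRight z X) := by
  induction X using BalTensor.induction_on with
  | h0 => simp
  | ht x y => rfl
  | ha X Y hX hY => simp [hX, hY]

end EnvRing

end Env

/-! ### Rules for the coproduct and the counit -/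

namespace LeftBialgebroid

variable {k A U : Type*} [CommRing k] [Ring A] [Algebra k A] [Ring U] [Algebra k U]
variable (ℬ : LeftBialgebroid k A U) {u : U} {n : ℕ} {x y : Fin n → U}

theorem comul_s_mul (h : ℬ.comul u = ∑ i, x i ⊗ᵇ y i) (a : A) :
    ℬ.comul (ℬ.s a * u) = ∑ i, (ℬ.s a * x i) ⊗ᵇ y i := by
  simpa using ℬ.comul_actions 1 a 1 1 u x y h

theorem comul_t_mul (h : ℬ.comul u = ∑ i, x i ⊗ᵇ y i) (a : A) :
    ℬ.comul (ℬ.t (op a) * u) = ∑ i, x i ⊗ᵇ (ℬ.t (op a) * y i) := by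
  simpa using ℬ.comul_actions 1 1 a 1 u x y h

theorem comul_mul_s (h : ℬ.comul u = ∑ i, x i ⊗ᵇ y i) (a : A) :
    ℬ.comul (u * ℬ.s a) = ∑ i, (x i * ℬ.s a) ⊗ᵇ y i := by
  simpa using ℬ.comul_actions 1 1 1 a u x y h

theorem comul_mul_t (h : ℬ.comul u = ∑ i, x i ⊗ᵇ y i) (a : A) :
    ℬ.comul (u * ℬ.t (op a)) = ∑ i, x i ⊗ᵇ (y i * ℬ.t (op a)) := by
  simpa using ℬ.comul_actions a 1 1 1 u x y h

theorem counit_s_mul (a : A) (u : U) : ℬ.counit (ℬ.s a * u) = a * ℬ.counit u := by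
  simpa using ℬ.counit_white a 1 u

theorem counit_t_mul (a : A) (u : U) : ℬ.counit (ℬ.t (op a) * u) = ℬ.counit u * a := by
  simpa using ℬ.counit_white 1 a u

theorem comul_leftS (a : A) (u : U) : ℬ.comul (ℬ.s a * u) = ℬ.leftS a (ℬ.comul u) := by
  obtain ⟨n, x, y, h⟩ := BalTensor.exists_rep (ℬ.comul u)
  rw [ℬ.comul_s_mul h, h]
  simp [EnvRing.leftS_tmul]

/-- Coassociativity with only one coproduct expanded, a form to which linear maps out of the triple
tensor product apply directly. -/
theorem coassoc_insertRight (h : ℬ.comul u = ∑ i, x i ⊗ᵇ y i) :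
    ∑ i, ℬ.insertRight₃ ℬ.t (y i) (ℬ.comul (x i)) = ∑ i, x i ⊗ᵇ ℬ.comul (y i) := by
  obtain ⟨m, x', x'', h'⟩ := BalTensor.exists_rep_family fun i => ℬ.comul (x i)
  rw [← ℬ.coassoc u x y x' x'' h h']
  simp [h', EnvRing.insertRight₃_tmul]

theorem sum_takeuchi (h : ℬ.comul u = ∑ i, x i ⊗ᵇ y i) (a : A) :
    (∑ i, (x i * ℬ.t (op a)) ⊗ᵇ y i : ℬ.Tensor) = ∑ i, x i ⊗ᵇ (y i * ℬ.s a) := by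
  have := ℬ.comul_takeuchi u a
  simpa only [h, map_sum, blackLeft_tmul, blackRight_tmul] using this

variable {R : Type*} [Ring R] [Algebra k R] (t : Aᵐᵒᵖ →ₐ[k] R)

/-- `r ⊗ y ↦ t(ε(y)) r` on `R_◁ ⊗_A ▹U`. -/
def counitRight : WTensor t ℬ.s →ₗ[k] R :=
  BalTensor.lift
    ((LinearMap.mul k R).flip.compl₂ (t.toLinearMap ∘ₗ
      (MulOpposite.opLinearEquiv k).toLinearMap ∘ₗ ℬ.counit))
    (fun a r y => by simp [ℬ.counit_s_mul, mul_assoc])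

theorem counitRight_tmul (r : R) (y : U) :
    ℬ.counitRight t (r ⊗ᵇ y) = t (op (ℬ.counit y)) * r := rfl

theorem counitRight_blackLeft (a : A) (X : WTensor t ℬ.s) :
    ℬ.counitRight t (blackLeft t ℬ.s a X) = ℬ.counitRight t X * t (op a) := by
  induction X using BalTensor.induction_on with
  | h0 => simp
  | ht x y => simp [blackLeft_tmul, counitRight_tmul, mul_assoc]
  | ha X Y hX hY => simp [hX, hY, add_mul]

end LeftBialgebroid

/-! ### Identities of the translation map -/

namespace LeftHopfAlgebroid

variable {k A U : Type*} [CommRing k] [Ring A] [Algebra k A] [Ring U] [Algebra k U]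
variable (𝒰 : LeftHopfAlgebroid k A U)

/-- The translation map as a linear map. -/
def translationL : U →ₗ[k] 𝒰.OpTensor :=
  𝒰.galois.symm.toLinearMap ∘ₗ (BalTensor.mk _ _).flip 1

theorem translationL_apply (u : U) : 𝒰.translationL u = 𝒰.translation u := rfl

theorem galois_translation (u : U) : 𝒰.galois (𝒰.translation u) = u ⊗ᵇ 1 :=
  𝒰.galois.apply_symm_apply _

theorem galois_opMulRight (z : U) (X : 𝒰.OpTensor) :
    𝒰.galois (𝒰.opMulRight z X) = 𝒰.mulRightSnd z (𝒰.galois X) := by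
  induction X using BalTensor.induction_on with
  | h0 => simp
  | ht u v =>
    obtain ⟨n, x, y, h⟩ := BalTensor.exists_rep (𝒰.comul u)
    rw [EnvRing.opMulRight_tmul, 𝒰.galois_tmul _ _ _ _ h, 𝒰.galois_tmul _ _ _ _ h]
    simp [EnvRing.mulRightSnd_tmul, mul_assoc]
  | ha X Y hX hY => simp [hX, hY]

theorem galois_opLeftS (a : A) (X : 𝒰.OpTensor) :
    𝒰.galois (𝒰.opLeftS a X) = 𝒰.leftS a (𝒰.galois X) := by
  induction X using BalTensor.induction_on with
  | h0 => simp
  | ht u v =>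
    obtain ⟨n, x, y, h⟩ := BalTensor.exists_rep (𝒰.comul u)
    rw [EnvRing.opLeftS_tmul, 𝒰.galois_tmul _ _ _ _ (𝒰.comul_s_mul h a), 𝒰.galois_tmul _ _ _ _ h]
    simp [EnvRing.leftS_tmul]
  | ha X Y hX hY => simp [hX, hY]

/-- β is linear for right multiplication on the second factor, so the translation map determines its
inverse. -/
theorem galois_symm_tmul (u z : U) :
    𝒰.galois.symm (u ⊗ᵇ z) = 𝒰.opMulRight z (𝒰.translation u) := by
  apply 𝒰.galois.injective
  rw [galois_opMulRight, galois_translation, LinearEquiv.apply_symm_apply,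
    EnvRing.mulRightSnd_tmul, one_mul]

/-- This is u₍₁₎₊ ⊗ u₍₁₎₋ u₍₂₎ = u ⊗ 1, the cancellation behind the reconstruction of u from φ. -/
theorem galois_symm_comul (u : U) : 𝒰.galois.symm (𝒰.comul u) = u ⊗ᵇ 1 := by
  obtain ⟨n, x, y, h⟩ := BalTensor.exists_rep (𝒰.comul u)
  rw [LinearEquiv.symm_apply_eq, 𝒰.galois_tmul _ _ _ _ h, h]
  simp

/-- Here and in the next three identities, β intertwines the operators in question, so both sides
are compared after applying β, where the translation of u becomes u ⊗ 1. -/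
theorem translation_s_mul (a : A) (u : U) :
    𝒰.translation (𝒰.s a * u) = 𝒰.opLeftS a (𝒰.translation u) := by
  apply 𝒰.galois.injective
  rw [galois_opLeftS, galois_translation, galois_translation, EnvRing.leftS_tmul]

theorem translation_t_mul (a : A) (u : U) :
    𝒰.translation (𝒰.t (op a) * u) = 𝒰.opMulRight (𝒰.s a) (𝒰.translation u) := by
  apply 𝒰.galois.injective
  rw [galois_opMulRight, galois_translation, galois_translation, EnvRing.mulRightSnd_tmul,
    WTensor.t_mul_tmul, mul_one, one_mul]

theorem translation_mul_s (a : A) (u : U) :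
    𝒰.translation (u * 𝒰.s a) = 𝒰.opMulS a (𝒰.translation u) := by
  let F : Module.End k 𝒰.Tensor := BalTensor.map (LinearMap.mulRight k (𝒰.s a)) LinearMap.id
    (fun b m => by simp [mul_assoc]) (fun _ _ => rfl)
  have hFt : ∀ x y, F (x ⊗ᵇ y) = (x * 𝒰.s a) ⊗ᵇ y := fun _ _ => rfl
  have hF : ∀ X, 𝒰.galois (𝒰.opMulS a X) = F (𝒰.galois X) := by
    intro X
    induction X using BalTensor.induction_on with
    | h0 => simp
    | ht u v =>
      obtain ⟨n, x, y, h⟩ := BalTensor.exists_rep (𝒰.comul u)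
      rw [EnvRing.opMulS_tmul, 𝒰.galois_tmul _ _ _ _ (𝒰.comul_mul_s h a),
        𝒰.galois_tmul _ _ _ _ h]
      simp [hFt]
    | ha X Y hX hY => simp [hX, hY]
  apply 𝒰.galois.injective
  rw [hF, galois_translation, galois_translation]
  rfl

/-- β carries multiplication of the first factor by t(a) on the left to multiplication of the second
factor by t(a) on the left; on u ⊗ 1 left and right multiplication coincide. -/
theorem opTMul_translation (a : A) (u : U) :
    𝒰.opTMul a (𝒰.translation u) = 𝒰.opMulRight (𝒰.t (op a)) (𝒰.translation u) := by
  let F : Module.End k 𝒰.Tensor := BalTensor.map LinearMap.id (LinearMap.mulLeft k (𝒰.t (op a)))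
    (fun _ _ => rfl) (fun b m => by simp [← mul_assoc, 𝒰.comm])
  have hFt : ∀ x y, F (x ⊗ᵇ y) = x ⊗ᵇ (𝒰.t (op a) * y) := fun _ _ => rfl
  have hF : ∀ X, 𝒰.galois (𝒰.opTMul a X) = F (𝒰.galois X) := by
    intro X
    induction X using BalTensor.induction_on with
    | h0 => simp
    | ht u v =>
      obtain ⟨n, x, y, h⟩ := BalTensor.exists_rep (𝒰.comul u)
      rw [EnvRing.opTMul_tmul, 𝒰.galois_tmul _ _ _ _ (𝒰.comul_t_mul h a),
        𝒰.galois_tmul _ _ _ _ h]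
      simp [hFt, mul_assoc]
    | ha X Y hX hY => simp [hX, hY]
  apply 𝒰.galois.injective
  rw [hF, galois_opMulRight, galois_translation, EnvRing.mulRightSnd_tmul]
  simp [hFt]

/-- Multiplication `x ⊗ y ↦ x c y` on `▶U ⊗_{Aᵒᵖ} U_◁`, mapped to an algebra `R`, for `c`
commuting with the image of the target map. -/
def sandwich {R : Type*} [Ring R] [Algebra k R] (ρ : U →ₐ[k] R) (c : R)
    (hc : ∀ a, c * ρ (𝒰.t (op a)) = ρ (𝒰.t (op a)) * c) : 𝒰.OpTensor →ₗ[k] R :=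
  BalTensor.lift (((LinearMap.mul k R).compl₁₂ (LinearMap.mulRight k c ∘ₗ ρ.toLinearMap)
    ρ.toLinearMap)) (fun a x y => by simp [mul_assoc, ← hc])

theorem sandwich_tmul {R : Type*} [Ring R] [Algebra k R] (ρ : U →ₐ[k] R) (c : R)
    (hc : ∀ a, c * ρ (𝒰.t (op a)) = ρ (𝒰.t (op a)) * c) (x y : U) :
    𝒰.sandwich ρ c hc (x ⊗ᵇ y) = ρ x * c * ρ y := rfl

/-- This is u₊ u₋ = s(ε(u)): the counit axiom gives that x ⊗ y ↦ s(ε(x)) y composed with β is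
multiplication, and β sends u₊ ⊗ u₋ to u ⊗ 1. -/
theorem sandwich_one_translation {R : Type*} [Ring R] [Algebra k R] (ρ : U →ₐ[k] R) (u : U) :
    𝒰.sandwich ρ 1 (fun _ => by simp) (𝒰.translation u) = ρ (𝒰.s (𝒰.counit u)) := by
  let F : 𝒰.Tensor →ₗ[k] R := BalTensor.lift ((LinearMap.mul k R).compl₁₂
    (ρ.toLinearMap ∘ₗ 𝒰.s.toLinearMap ∘ₗ 𝒰.counit) ρ.toLinearMap)
    (fun a x y => by simp [𝒰.counit_t_mul, mul_assoc])
  have hF : ∀ X, F (𝒰.galois X) = 𝒰.sandwich ρ 1 (fun _ => by simp) X := by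
    intro X
    induction X using BalTensor.induction_on with
    | h0 => simp
    | ht u v =>
      obtain ⟨n, x, y, h⟩ := BalTensor.exists_rep (𝒰.comul u)
      rw [𝒰.galois_tmul _ _ _ _ h, sandwich_tmul]
      conv_rhs => rw [← 𝒰.counit_comul u x y h]
      simp [F, BalTensor.lift_tmul, Finset.sum_mul, mul_assoc]
    | ha X Y hX hY => simp [hX, hY]
  rw [← hF, galois_translation]
  simp [F, BalTensor.lift_tmul]

variable {R : Type*} [Ring R] [Algebra k R]

/-- `id ⊗_A (u ↦ u₊ ⊗ u₋)`. -/
def idTranslation (t : Aᵐᵒᵖ →ₐ[k] R) : WTensor t 𝒰.s →ₗ[k] 𝒰.MixedOver t :=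
  BalTensor.map LinearMap.id 𝒰.translationL (fun _ _ => rfl)
    (fun a u => 𝒰.translation_s_mul a u)

theorem idTranslation_tmul (t : Aᵐᵒᵖ →ₐ[k] R) (x : R) (y : U) :
    𝒰.idTranslation t (x ⊗ᵇ y) = x ⊗ᵇ 𝒰.translation y := rfl

/-- `u ⊗ z ↦ u₍₁₎ ⊗ (u₍₂₎ ⊗ z)`. -/
def comulMixed : 𝒰.OpTensor →ₗ[k] 𝒰.MixedTensor :=
  BalTensor.lift
    (LinearMap.mk₂ k (fun u z => 𝒰.insertRight 𝒰.t z (𝒰.comul u)) (fun _ _ _ => by simp)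
      (fun _ _ _ => by simp)
      (fun u z z' => by
        obtain ⟨n, x, y, h⟩ := BalTensor.exists_rep (𝒰.comul u)
        simp [h, EnvRing.insertRight_tmul, BalTensor.tmul_add, Finset.sum_add_distrib])
      (fun c u z => by
        obtain ⟨n, x, y, h⟩ := BalTensor.exists_rep (𝒰.comul u)
        simp [h, EnvRing.insertRight_tmul, BalTensor.tmul_smul, Finset.smul_sum]))
    (fun a u z => by
      obtain ⟨n, x, y, h⟩ := BalTensor.exists_rep (𝒰.comul u)
      simp [h, 𝒰.comul_mul_t h, EnvRing.insertRight_tmul, EnvRing.OpTensor.mul_t_tmul])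

theorem comulMixed_tmul (u z : U) :
    𝒰.comulMixed (u ⊗ᵇ z) = 𝒰.insertRight 𝒰.t z (𝒰.comul u) := by
  rw [comulMixed, BalTensor.lift_tmul, LinearMap.mk₂_apply]

/-- `x ⊗ y ↦ x₍₁₎ ⊗ (x₍₂₎ ⊗ y)`. -/
def comulId : 𝒰.Tensor →ₗ[k] 𝒰.Tensor3 𝒰.t :=
  BalTensor.lift
    (LinearMap.mk₂ k (fun u z => 𝒰.insertRight₃ 𝒰.t z (𝒰.comul u)) (fun _ _ _ => by simp)
      (fun _ _ _ => by simp)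
      (fun u z z' => by
        obtain ⟨n, x, y, h⟩ := BalTensor.exists_rep (𝒰.comul u)
        simp [h, EnvRing.insertRight₃_tmul, BalTensor.tmul_add, Finset.sum_add_distrib])
      (fun c u z => by
        obtain ⟨n, x, y, h⟩ := BalTensor.exists_rep (𝒰.comul u)
        simp [h, EnvRing.insertRight₃_tmul, BalTensor.tmul_smul, Finset.smul_sum]))
    (fun a u z => by
      obtain ⟨n, x, y, h⟩ := BalTensor.exists_rep (𝒰.comul u)
      simp [h, 𝒰.comul_t_mul h, EnvRing.insertRight₃_tmul, WTensor.t_mul_tmul])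

theorem comulId_tmul (u z : U) :
    𝒰.comulId (u ⊗ᵇ z) = 𝒰.insertRight₃ 𝒰.t z (𝒰.comul u) := by
  rw [comulId, BalTensor.lift_tmul, LinearMap.mk₂_apply]

/-- `id ⊗_A β` for the Hopf-Galois map `β`. -/
def idGalois : 𝒰.MixedTensor →ₗ[k] 𝒰.Tensor3 𝒰.t :=
  BalTensor.map (LinearEquiv.refl k U).toLinearMap 𝒰.galois.toLinearMap (fun _ _ => rfl)
    (fun a X => 𝒰.galois_opLeftS a X)

theorem idGalois_injective : Function.Injective 𝒰.idGalois :=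
  BalTensor.map_injective (LinearEquiv.refl k U) 𝒰.galois _ _

theorem idGalois_tmul (x : U) (Y : 𝒰.OpTensor) : 𝒰.idGalois (x ⊗ᵇ Y) = x ⊗ᵇ 𝒰.galois Y := rfl

/-- On u ⊗ z both sides are u₍₁₎ ⊗ u₍₂₎ ⊗ u₍₃₎ z, so this is coassociativity. -/
theorem idGalois_comulMixed (X : 𝒰.OpTensor) :
    𝒰.idGalois (𝒰.comulMixed X) = 𝒰.comulId (𝒰.galois X) := by
  induction X using BalTensor.induction_on with
  | h0 => simp
  | ht u z =>
    obtain ⟨n, x, y, h⟩ := BalTensor.exists_rep (𝒰.comul u)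
    let F : 𝒰.Tensor3 𝒰.t →ₗ[k] 𝒰.Tensor3 𝒰.t := BalTensor.map LinearMap.id (𝒰.mulRightSnd z)
      (fun _ _ => rfl) (fun a X => 𝒰.mulRightSnd_leftS z a X)
    have hF1 : ∀ y X, F (𝒰.insertRight₃ 𝒰.t y X) = 𝒰.insertRight₃ 𝒰.t (y * z) X := by
      intro y X
      induction X using BalTensor.induction_on with
      | h0 => simp
      | ht u v => rfl
      | ha X Y hX hY => simp [hX, hY]
    have hF2 : ∀ x y, F (x ⊗ᵇ 𝒰.comul y) = x ⊗ᵇ 𝒰.galois (y ⊗ᵇ z) := by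
      intro x y
      obtain ⟨m, x', y', h'⟩ := BalTensor.exists_rep (𝒰.comul y)
      have : F (x ⊗ᵇ 𝒰.comul y) = x ⊗ᵇ 𝒰.mulRightSnd z (𝒰.comul y) := rfl
      rw [this, 𝒰.galois_tmul _ _ _ _ h', h']
      simp [EnvRing.mulRightSnd_tmul]
    have key := congrArg F (𝒰.coassoc_insertRight h)
    simp only [map_sum, hF1, hF2] at key
    rw [comulMixed_tmul, 𝒰.galois_tmul _ _ _ _ h, h]
    simp only [map_sum, EnvRing.insertRight_tmul, idGalois_tmul, comulId_tmul, key]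
  | ha X Y hX hY => simp [hX, hY]

/-- `u₍₁₎ ⊗ u₍₂₎₊ ⊗ u₍₂₎₋ = u₊₍₁₎ ⊗ u₊₍₂₎ ⊗ u₋`. -/
theorem idTranslation_comul (u : U) :
    𝒰.idTranslation 𝒰.t (𝒰.comul u) = 𝒰.comulMixed (𝒰.translation u) := by
  apply 𝒰.idGalois_injective
  rw [idGalois_comulMixed, galois_translation, comulId_tmul]
  obtain ⟨n, x, y, h⟩ := BalTensor.exists_rep (𝒰.comul u)
  simp [h, idTranslation_tmul, idGalois_tmul, galois_translation, EnvRing.insertRight₃_tmul]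

end LeftHopfAlgebroid

/-! ### Contraction along a dual basis -/

/-- A dual basis of the left `Aᵒᵖ`-module `U_◁`, indexed by `U` itself. -/
structure EnvRing.DualBasis {k A U : Type*} [CommRing k] [Ring A] [Algebra k A]
    [Ring U] [Algebra k U] (E : EnvRing k A U) where
  coord : U →ₗ[k] U →₀ Aᵐᵒᵖ
  coord_t_mul : ∀ a z, coord (E.t a * z) = a • coord z
  sum_coord : ∀ z, (coord z).sum (fun e a => E.t a * e) = z

theorem EnvRing.WhiteRightProjective.nonempty_dualBasis {k A U : Type*} [CommRing k] [Ring A]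
    [Algebra k A] [Ring U] [Algebra k U] {E : EnvRing k A U} (h : E.WhiteRightProjective) :
    Nonempty E.DualBasis := by
  let : Module Aᵐᵒᵖ U := Module.compHom U (E.t : Aᵐᵒᵖ →+* U)
  have hsmul : ∀ (a : Aᵐᵒᵖ) (z : U), a • z = E.t a * z := fun _ _ => rfl
  obtain ⟨f, hf⟩ := h.out
  refine ⟨⟨⟨⟨f, map_add f⟩, fun c z => ?_⟩, fun a z => f.map_smul a z, fun z => ?_⟩⟩
  -- The splitting supplied by projectivity is only Aᵒᵖ-linear; k-linearity follows because k acts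
  -- on U through Aᵒᵖ.
  · have h1 : c • z = algebraMap k Aᵐᵒᵖ c • z := by
      rw [hsmul, AlgHom.commutes, Algebra.smul_def]
    have h2 := f.map_smul (algebraMap k Aᵐᵒᵖ c) z
    rw [← h1, algebraMap_smul] at h2
    exact h2
  · exact hf z

namespace LeftHopfAlgebroid

variable {k A U R : Type*} [CommRing k] [Ring A] [Algebra k A] [Ring U] [Algebra k U]
  [Ring R] [Algebra k R]
variable (𝒰 : LeftHopfAlgebroid k A U)

/-- `x ⊗ Y ↦ x t(a) ⊗ Y`. -/
def mixedMulT (a : A) : Module.End k 𝒰.MixedTensor :=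
  BalTensor.map (LinearMap.mulRight k (𝒰.t (op a))) LinearMap.id
    (fun b m => by simp [mul_assoc]) (fun _ _ => rfl)

theorem mixedMulT_tmul (a : A) (x : U) (Y : 𝒰.OpTensor) :
    𝒰.mixedMulT a (x ⊗ᵇ Y) = (x * 𝒰.t (op a)) ⊗ᵇ Y := rfl

theorem opMulS_opLeftS (a b : A) (X : 𝒰.OpTensor) :
    𝒰.opMulS a (𝒰.opLeftS b X) = 𝒰.opLeftS b (𝒰.opMulS a X) := by
  induction X using BalTensor.induction_on with
  | h0 => simp
  | ht x y => simp [EnvRing.opMulS_tmul, EnvRing.opLeftS_tmul, mul_assoc]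
  | ha X Y hX hY => simp [hX, hY]

theorem opTMul_opLeftS (a b : A) (X : 𝒰.OpTensor) :
    𝒰.opTMul a (𝒰.opLeftS b X) = 𝒰.opLeftS b (𝒰.opTMul a X) := by
  induction X using BalTensor.induction_on with
  | h0 => simp
  | ht x y => simp [EnvRing.opTMul_tmul, EnvRing.opLeftS_tmul, ← mul_assoc, 𝒰.comm]
  | ha X Y hX hY => simp [hX, hY]

/-- `x ⊗ (y ⊗ z) ↦ x ⊗ (y s(a) ⊗ z)`. -/
def mixedMulS (a : A) : Module.End k 𝒰.MixedTensor :=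
  BalTensor.map LinearMap.id (𝒰.opMulS a) (fun _ _ => rfl)
    (fun b X => 𝒰.opMulS_opLeftS a b X)

theorem mixedMulS_tmul (a : A) (x : U) (Y : 𝒰.OpTensor) :
    𝒰.mixedMulS a (x ⊗ᵇ Y) = x ⊗ᵇ 𝒰.opMulS a Y := rfl

/-- `x ⊗ (y ⊗ z) ↦ x ⊗ (t(a) y ⊗ z)`. -/
def mixedTMul (a : A) : Module.End k 𝒰.MixedTensor :=
  BalTensor.map LinearMap.id (𝒰.opTMul a) (fun _ _ => rfl)
    (fun b X => 𝒰.opTMul_opLeftS a b X)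

theorem mixedTMul_tmul (a : A) (x : U) (Y : 𝒰.OpTensor) :
    𝒰.mixedTMul a (x ⊗ᵇ Y) = x ⊗ᵇ 𝒰.opTMul a Y := rfl

/-- `x ⊗ (y ⊗ z) ↦ x ⊗ (y ⊗ z w)`. -/
def mixedMulRight (w : U) : Module.End k 𝒰.MixedTensor :=
  BalTensor.map LinearMap.id (𝒰.opMulRight w) (fun _ _ => rfl)
    (fun b X => 𝒰.opMulRight_opLeftS w b X)

theorem mixedMulRight_tmul (w : U) (x : U) (Y : 𝒰.OpTensor) :
    𝒰.mixedMulRight w (x ⊗ᵇ Y) = x ⊗ᵇ 𝒰.opMulRight w Y := rfl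

section Contraction

variable (D : 𝒰.DualBasis) (ρ : U →ₐ[k] R)

/-- `y ⊗ z ↦ t(ε(y₁)) r z₁`, with `y₁ ⊗ z₁` the expansion of `y ⊗ z` along the dual basis. -/
def contractAux (r : R) : 𝒰.OpTensor →ₗ[k] R :=
  BalTensor.lift
    (LinearMap.mk₂ k
      (fun y z => (D.coord z).sum fun e a =>
        ρ (𝒰.t (op (𝒰.counit (y * 𝒰.t a)))) * r * ρ e)
      (fun y y' z => by simp [add_mul, Finsupp.sum_add])
      (fun c y z => by simp [Finsupp.smul_sum])
      (fun y z z' => by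
        rw [map_add, Finsupp.sum_add_index'] <;> simp [add_mul, mul_add])
      (fun c y z => by
        rw [map_smul, Finsupp.sum_smul_index' (by simp), Finsupp.smul_sum]
        simp))
    (fun a y z => by
      simp only [LinearMap.mk₂_apply, LinearMap.mulRight_apply, LinearMap.mulLeft_apply,
        D.coord_t_mul]
      rw [Finsupp.sum_smul_index' (by simp)]
      simp [mul_assoc])

theorem contractAux_tmul (r : R) (y z : U) :
    𝒰.contractAux D ρ r (y ⊗ᵇ z) = (D.coord z).sum fun e a =>
        ρ (𝒰.t (op (𝒰.counit (y * 𝒰.t a)))) * r * ρ e := by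
  rw [contractAux, BalTensor.lift_tmul, LinearMap.mk₂_apply]

variable {ρ} {t : Aᵐᵒᵖ →ₐ[k] R} (ht : ∀ a, ρ (𝒰.t a) = t a)

/-- The contraction `r ⊗ (y ⊗ z) ↦ t(ε(y)) r z`, evaluated after expanding `z` along a dual
basis. On the image of `(R ×_A U) ⊗_{Aᵒᵖ} U` it does not depend on the dual basis. -/
def contraction : 𝒰.MixedOver t →ₗ[k] R :=
  BalTensor.lift
    (LinearMap.mk₂ k (fun r X => 𝒰.contractAux D ρ r X)
      (fun r r' X => by
        induction X using BalTensor.induction_on with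
        | h0 => simp
        | ht x y => simp [contractAux_tmul, mul_add, add_mul, Finsupp.sum_add]
        | ha X Y hX hY => simp only [map_add, hX, hY]; abel)
      (fun c r X => by
        induction X using BalTensor.induction_on with
        | h0 => simp
        | ht x y => simp [contractAux_tmul, Finsupp.smul_sum]
        | ha X Y hX hY => simp only [map_add, hX, hY, smul_add])
      (fun _ _ _ => by simp) (fun _ _ _ => by simp))
    (fun a r X => by
      simp only [LinearMap.mk₂_apply, LinearMap.mulLeft_apply]
      induction X using BalTensor.induction_on with
      | h0 => simp
      | ht x y =>
        simp [contractAux_tmul, EnvRing.opLeftS_tmul, mul_assoc, 𝒰.counit_s_mul, ht]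
      | ha X Y hX hY => simp only [map_add, hX, hY])

theorem contraction_tmul (r : R) (X : 𝒰.OpTensor) :
    𝒰.contraction D ht (r ⊗ᵇ X) = 𝒰.contractAux D ρ r X := by
  rw [contraction, BalTensor.lift_tmul, LinearMap.mk₂_apply]

/-- The rule ε(y t(a)) = ε(y s(a)) turns the coefficient of the dual basis into the right hand
operator of the Takeuchi condition. -/
theorem contraction_insertRight_eq_sum (X : WTensor t 𝒰.s) (z : U) :
    𝒰.contraction D ht (𝒰.insertRight t z X) = (D.coord z).sum fun e a =>
      𝒰.counitRight t (blackRight t 𝒰.s a.unop X) * ρ e := by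
  induction X using BalTensor.induction_on with
  | h0 => simp
  | ht x y =>
    simp only [EnvRing.insertRight_tmul, contraction_tmul, contractAux_tmul, blackRight_tmul,
      LeftBialgebroid.counitRight_tmul, ← 𝒰.counit_black, ht]
    rfl
  | ha X Y hX hY => simp [hX, hY, add_mul, Finsupp.sum_add]

/-- The Takeuchi condition moves each coefficient from y back across x, where it meets its basis
element; the sum then reassembles z and the dual basis disappears. -/
theorem contraction_insertRight {X : WTensor t 𝒰.s} (hX : IsTakeuchi X) (z : U) :
    𝒰.contraction D ht (𝒰.insertRight t z X) = 𝒰.counitRight t X * ρ z := by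
  rw [contraction_insertRight_eq_sum]
  conv_rhs => rw [← D.sum_coord z]
  simp only [← hX _, LeftBialgebroid.counitRight_blackLeft, Finsupp.sum, map_sum,
    Finset.mul_sum, map_mul, ht, MulOpposite.op_unop, mul_assoc]

/-- `x ⊗ Y ↦ r ρ(x) r' ⊗ Y`. -/
def mixedMap (r r' : R) (hr : ∀ a, r * t (op a) = t (op a) * r) :
    𝒰.MixedTensor →ₗ[k] 𝒰.MixedOver t :=
  BalTensor.map (LinearMap.mulLeft k r ∘ₗ LinearMap.mulRight k r' ∘ₗ ρ.toLinearMap) LinearMap.id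
    (fun a x => by simp [ht, ← mul_assoc, hr]) (fun _ _ => rfl)

theorem mixedMap_tmul (r r' : R) (hr : ∀ a, r * t (op a) = t (op a) * r) (x : U)
    (Y : 𝒰.OpTensor) : 𝒰.mixedMap ht r r' hr (x ⊗ᵇ Y) = (r * (ρ x * r')) ⊗ᵇ Y := rfl

/-- Since r' commutes with the image of t, r u₍₁₎ r' ⊗ u₍₂₎ remains in the Takeuchi product, so the
naive formula applies. The hypothesis on r lets t(ε(u₍₂₎)) pass to u₍₁₎, where the counit axiom
finishes. -/
theorem contraction_mixedMap_comulMixed (r r' : R) (hr : ∀ a, r * t (op a) = t (op a) * r)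
    (hr' : ∀ a, r' * ρ (𝒰.t (op a)) = ρ (𝒰.t (op a)) * r') (X : 𝒰.OpTensor) :
    𝒰.contraction D ht (𝒰.mixedMap ht r r' hr (𝒰.comulMixed X)) =
      r * 𝒰.sandwich ρ r' hr' X := by
  induction X using BalTensor.induction_on with
  | h0 => simp
  | ht u z =>
    obtain ⟨n, x, y, h⟩ := BalTensor.exists_rep (𝒰.comul u)
    let F : 𝒰.Tensor →ₗ[k] WTensor t 𝒰.s :=
      BalTensor.map (LinearMap.mulLeft k r ∘ₗ LinearMap.mulRight k r' ∘ₗ ρ.toLinearMap)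
        LinearMap.id (fun a x => by simp [ht, ← mul_assoc, hr]) (fun _ _ => rfl)
    have hF : ∀ x y, F (x ⊗ᵇ y) = (r * (ρ x * r')) ⊗ᵇ y := fun _ _ => rfl
    have h1 : 𝒰.mixedMap ht r r' hr (𝒰.insertRight 𝒰.t z (𝒰.comul u)) =
        𝒰.insertRight t z (F (𝒰.comul u)) := by
      simp [h, EnvRing.insertRight_tmul, mixedMap_tmul, hF]
    have h2 : IsTakeuchi (F (𝒰.comul u)) := by
      intro a
      have := congrArg F (𝒰.sum_takeuchi h a)
      simp only [map_sum, hF, map_mul, mul_assoc, ← hr'] at this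
      simpa [h, hF, blackLeft_tmul, blackRight_tmul, mul_assoc, ← ht] using this
    rw [comulMixed_tmul, h1, contraction_insertRight _ _ _ h2, sandwich_tmul]
    have h3 : 𝒰.counitRight t (F (𝒰.comul u)) = r * (ρ u * r') := by
      conv_rhs => rw [← 𝒰.comul_counit u x y h]
      simp only [h, map_sum, hF, LeftBialgebroid.counitRight_tmul, ← mul_assoc, ← hr, Finset.mul_sum,
        Finset.sum_mul, map_mul, ht]
    rw [h3]
    simp [mul_assoc]
  | ha X Y hX hY => simp [hX, hY, mul_add]

/-- `t(ε(u₍₂₎₊)) r u₍₁₎ r' u₍₂₎₋ = r u₊ r' u₋`. -/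
theorem contraction_mixedMap_idTranslation (r r' : R) (hr : ∀ a, r * t (op a) = t (op a) * r)
    (hr' : ∀ a, r' * ρ (𝒰.t (op a)) = ρ (𝒰.t (op a)) * r') (u : U) :
    𝒰.contraction D ht (𝒰.mixedMap ht r r' hr (𝒰.idTranslation 𝒰.t (𝒰.comul u))) =
      r * 𝒰.sandwich ρ r' hr' (𝒰.translation u) := by
  rw [idTranslation_comul, contraction_mixedMap_comulMixed]

end Contraction

/-! ### Existence and uniqueness of the contracted value -/

section Contracts

variable (D : 𝒰.DualBasis)

theorem id_t (a : Aᵐᵒᵖ) : AlgHom.id k U (𝒰.t a) = 𝒰.t a := rfl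

/-- The contraction on `U_◁ ⊗_A (▹▶U ⊗_{Aᵒᵖ} U_◁)`. -/
def contract : 𝒰.MixedTensor →ₗ[k] U :=
  𝒰.contraction D 𝒰.id_t

theorem contract_insertRight {X : 𝒰.Tensor} (hX : IsTakeuchi X) (z : U) :
    𝒰.contract D (𝒰.insertRight 𝒰.t z X) =
      𝒰.counitRight 𝒰.t X * z :=
  𝒰.contraction_insertRight D _ hX z

theorem contract_tmul_tmul (x y z : U) :
    𝒰.contract D (x ⊗ᵇ (y ⊗ᵇ z)) = (D.coord z).sum fun e a =>
      𝒰.t (op (𝒰.counit (y * 𝒰.t a))) * x * e := by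
  rw [contract, contraction_tmul, contractAux_tmul]
  simp only [AlgHom.id_apply]

variable {𝒰} in
-- Uniqueness: whatever lift to (U ×_A U) ⊗ U is chosen, `contract` computes the same value from X
-- alone.
theorem Contracts.eq_contract {X : 𝒰.MixedTensor} {c : U} (h : 𝒰.Contracts X c) :
    c = 𝒰.contract D X := by
  obtain ⟨m, n, x, y, z, hT, rfl, rfl⟩ := h
  rw [map_sum]
  refine Finset.sum_congr rfl fun j _ => ?_
  have := 𝒰.contract_insertRight D (hT j) (z j)
  simpa [EnvRing.insertRight_tmul, LeftBialgebroid.counitRight_tmul, Finset.sum_mul] using this.symm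

/-- `x ⊗ (y ⊗ z) ↦ x ⊗ y t(f(z))`, for the coordinate function `f` at `e`. -/
def mixedCoord (e : U) : 𝒰.MixedTensor →ₗ[k] 𝒰.Tensor :=
  BalTensor.map LinearMap.id
    (BalTensor.lift ((LinearMap.mul k U).compl₂
        (𝒰.t.toLinearMap ∘ₗ Finsupp.lapply e ∘ₗ D.coord))
      (fun a y z => by simp [D.coord_t_mul, mul_assoc]))
    (fun _ _ => rfl)
    (fun a X => by
      induction X using BalTensor.induction_on with
      | h0 => simp
      | ht x y => simp [BalTensor.lift_tmul, EnvRing.opLeftS_tmul, mul_assoc]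
      | ha X Y hX hY => rw [map_add, map_add, hX, hY, map_add, map_add])

theorem mixedCoord_tmul (e x y z : U) :
    𝒰.mixedCoord D e (x ⊗ᵇ (y ⊗ᵇ z)) = x ⊗ᵇ (y * 𝒰.t (D.coord z e)) := rfl

/-- Coefficients are multiplied in through t, whose image commutes with that of s; invariance
therefore passes to each coordinate. -/
theorem isTakeuchi_mixedCoord {X : 𝒰.MixedTensor} (hX : ∀ a, 𝒰.mixedMulT a X = 𝒰.mixedMulS a X)
    (e : U) : IsTakeuchi (𝒰.mixedCoord D e X) := by
  intro a
  have h1 := congrArg (𝒰.mixedCoord D e) (hX a)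
  obtain ⟨n, x, y, z, rfl⟩ := BalTensor.exists_rep_nested X
  simp only [map_sum, mixedMulT_tmul, mixedMulS_tmul, EnvRing.opMulS_tmul, mixedCoord_tmul] at h1
  simp only [map_sum, mixedCoord_tmul, blackLeft_tmul, blackRight_tmul, h1]
  refine Finset.sum_congr rfl fun i _ => ?_
  rw [mul_assoc, mul_assoc, ← MulOpposite.op_unop (D.coord (z i) e), 𝒰.comm]

/-- Existence: expanding every third factor along the finitely many basis elements that occur gives
an explicit lift, whose Takeuchi parts are the coordinates of X. -/
theorem contracts_contract {X : 𝒰.MixedTensor} (hX : ∀ a, 𝒰.mixedMulT a X = 𝒰.mixedMulS a X) :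
    𝒰.Contracts X (𝒰.contract D X) := by
  obtain ⟨n, x, y, z, rfl⟩ := BalTensor.exists_rep_nested X
  classical
  let S : Finset U := Finset.univ.biUnion fun i => (D.coord (z i)).support
  let e : Fin S.card → U := fun j => (S.equivFin.symm j : U)
  have hz : ∀ i, z i = ∑ j, 𝒰.t (D.coord (z i) (e j)) * e j := by
    intro i
    conv_lhs => rw [← D.sum_coord (z i)]
    rw [Finsupp.sum_of_support_subset (s := S) _
      (Finset.subset_biUnion_of_mem (fun i => (D.coord (z i)).support) (Finset.mem_univ i)) _
      (by simp), ← Finset.sum_coe_sort, ← S.equivFin.symm.sum_comp]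
  have h : 𝒰.Contracts (∑ i, x i ⊗ᵇ (y i ⊗ᵇ z i))
      (∑ j, ∑ i, 𝒰.t (op (𝒰.counit (y i * 𝒰.t (D.coord (z i) (e j))))) * x i * e j) := by
    refine ⟨n, S.card, fun i _ => x i, fun i j => y i * 𝒰.t (D.coord (z i) (e j)), e,
      fun j => ?_, ?_, rfl⟩
    · simpa [mixedCoord_tmul] using 𝒰.isTakeuchi_mixedCoord D hX (e j)
    · rw [Finset.sum_comm]
      refine Finset.sum_congr rfl fun i _ => ?_
      conv_lhs => rw [hz i]
      rw [BalTensor.tmul_sum, BalTensor.tmul_sum]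
      refine Finset.sum_congr rfl fun j _ => ?_
      change x i ⊗ᵇ _ = x i ⊗ᵇ ((y i * 𝒰.t (D.coord (z i) (e j))) ⊗ᵇ e j)
      rw [← MulOpposite.op_unop (D.coord (z i) (e j)), EnvRing.OpTensor.mul_t_tmul]
  rw [← h.eq_contract D]
  exact h

theorem contracts_iff {X : 𝒰.MixedTensor} (hX : ∀ a, 𝒰.mixedMulT a X = 𝒰.mixedMulS a X) (c : U) :
    𝒰.Contracts X c ↔ c = 𝒰.contract D X :=
  ⟨fun h => h.eq_contract D, fun h => h ▸ 𝒰.contracts_contract D hX⟩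

variable {𝒰} in
theorem Contracts.mul_right {X : 𝒰.MixedTensor} {c : U} (h : 𝒰.Contracts X c) (w : U) :
    𝒰.Contracts (𝒰.mixedMulRight w X) (c * w) := by
  obtain ⟨m, n, x, y, z, hT, rfl, rfl⟩ := h
  refine ⟨m, n, x, y, fun j => z j * w, hT, ?_, ?_⟩
  · simp [mixedMulRight_tmul, EnvRing.opMulRight_tmul]
  · simp [Finset.sum_mul, mul_assoc]

/-- The coordinates of z w are unrelated to those of z, so linearity is not visible on `contract`.
It is evident for lifts, and uniqueness transfers it; hence the invariance hypothesis. -/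
theorem contract_mixedMulRight {X : 𝒰.MixedTensor}
    (hX : ∀ a, 𝒰.mixedMulT a X = 𝒰.mixedMulS a X) (w : U) :
    𝒰.contract D (𝒰.mixedMulRight w X) = 𝒰.contract D X * w :=
  (((𝒰.contracts_contract D hX).mul_right w).eq_contract D).symm

theorem contract_mixedTMul (a : A) (X : 𝒰.MixedTensor) :
    𝒰.contract D (𝒰.mixedTMul a X) = 𝒰.t (op a) * 𝒰.contract D X := by
  obtain ⟨n, x, y, z, rfl⟩ := BalTensor.exists_rep_nested X
  simp only [map_sum, Finset.mul_sum]
  refine Finset.sum_congr rfl fun i _ => ?_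
  rw [mixedTMul_tmul, EnvRing.opTMul_tmul, contract_tmul_tmul, contract_tmul_tmul,
    Finsupp.mul_sum]
  simp [mul_assoc, 𝒰.counit_t_mul]

theorem contract_mixedMap_one (b : U) (hb : ∀ a, b * 𝒰.t (op a) = 𝒰.t (op a) * b)
    (X : 𝒰.MixedTensor) :
    𝒰.contract D (𝒰.mixedMap 𝒰.id_t b 1 hb X) =
      b * 𝒰.contract D X := by
  obtain ⟨n, x, y, z, rfl⟩ := BalTensor.exists_rep_nested X
  simp only [map_sum, Finset.mul_sum]
  refine Finset.sum_congr rfl fun i _ => ?_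
  rw [mixedMap_tmul, contract_tmul_tmul, contract_tmul_tmul, Finsupp.mul_sum]
  simp only [AlgHom.id_apply, mul_one, ← mul_assoc, hb]

end Contracts

end LeftHopfAlgebroid

/-! ### The coaction of V on U along π -/

section WTensorMul

variable {k A R V : Type*} [CommRing k] [Ring A] [Algebra k A] [Ring R] [Algebra k R]
  [Ring V] [Algebra k V] (t : Aᵐᵒᵖ →ₐ[k] R) (s : A →ₐ[k] V)

/-- `x ⊗ v ↦ x x' ⊗ v v'` on `R_◁ ⊗_A ▹V`. -/
def WTensor.mulRight (x' : R) (v' : V) : Module.End k (WTensor t s) :=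
  BalTensor.map (LinearMap.mulRight k x') (LinearMap.mulRight k v')
    (fun a m => by simp [mul_assoc]) (fun a m => by simp [mul_assoc])

theorem WTensor.mulRight_tmul (x x' : R) (v v' : V) :
    WTensor.mulRight t s x' v' (x ⊗ᵇ v) = (x * x') ⊗ᵇ (v * v') := rfl

variable {t s}

/-- Left multiplication on `R_◁ ⊗_A ▹V` by an element of `R ×_A V`. -/
def WTensor.mulLeft (X : WTensor t s) (hX : IsTakeuchi X) : Module.End k (WTensor t s) :=
  BalTensor.lift
    (LinearMap.mk₂ k (fun x v => WTensor.mulRight t s x v X)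
      (fun x x' v => by
        obtain ⟨n, y, z, rfl⟩ := BalTensor.exists_rep X
        simp [WTensor.mulRight_tmul, mul_add, BalTensor.add_tmul, Finset.sum_add_distrib])
      (fun c x v => by
        obtain ⟨n, y, z, rfl⟩ := BalTensor.exists_rep X
        simp [WTensor.mulRight_tmul, BalTensor.smul_tmul, Finset.smul_sum])
      (fun x v v' => by
        obtain ⟨n, y, z, rfl⟩ := BalTensor.exists_rep X
        simp [WTensor.mulRight_tmul, mul_add, BalTensor.tmul_add, Finset.sum_add_distrib])
      (fun c x v => by
        obtain ⟨n, y, z, rfl⟩ := BalTensor.exists_rep X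
        simp [WTensor.mulRight_tmul, BalTensor.tmul_smul, Finset.smul_sum]))
    -- Being balanced in x ⊗ v is the Takeuchi condition on X, multiplied on the right by x ⊗ v.
    (fun a x v => by
      have h := congrArg (WTensor.mulRight t s x v) (hX a)
      obtain ⟨n, y, z, rfl⟩ := BalTensor.exists_rep X
      simpa [WTensor.mulRight_tmul, blackLeft_tmul, blackRight_tmul, mul_assoc] using h)

theorem WTensor.mulLeft_tmul (X : WTensor t s) (hX : IsTakeuchi X) (x : R) (v : V) :
    WTensor.mulLeft X hX (x ⊗ᵇ v) = WTensor.mulRight t s x v X := by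
  rw [WTensor.mulLeft, BalTensor.lift_tmul, LinearMap.mk₂_apply]

end WTensorMul

namespace LeftHopfAlgebroid.Hom

variable {k A U V : Type*} [CommRing k] [Ring A] [Algebra k A]
  [Ring U] [Algebra k U] [Ring V] [Algebra k V]
  {𝒰 : LeftHopfAlgebroid k A U} {𝒱 : LeftHopfAlgebroid k A V} (π : 𝒰.Hom 𝒱)

theorem isTakeuchi_coaction (u : U) : IsTakeuchi (π.coaction u) := by
  intro a
  obtain ⟨n, x, y, h⟩ := BalTensor.exists_rep (𝒰.comul u)
  have := congrArg π.idTensor (𝒰.sum_takeuchi h a)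
  simpa [π.coaction_eq h, blackLeft_tmul, blackRight_tmul, Hom.idTensor_tmul, π.hom_s] using this

/-- `x ⊗ v ↦ x ⊗ t(a) v` on `U_◁ ⊗_A ▹V`. -/
def tMulSnd (_ : 𝒰.Hom 𝒱) (a : A) : Module.End k (WTensor 𝒰.t 𝒱.s) :=
  BalTensor.map LinearMap.id (LinearMap.mulLeft k (𝒱.t (op a))) (fun _ _ => rfl)
    (fun b m => by simp [← mul_assoc, 𝒱.comm])

theorem tMulSnd_tmul (a : A) (x : U) (v : V) :
    π.tMulSnd a (x ⊗ᵇ v) = x ⊗ᵇ (𝒱.t (op a) * v) := rfl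

theorem coaction_t_mul (a : A) (u : U) :
    π.coaction (𝒰.t (op a) * u) = π.tMulSnd a (π.coaction u) := by
  obtain ⟨n, x, y, h⟩ := BalTensor.exists_rep (𝒰.comul u)
  simp [π.coaction_eq h, π.coaction_eq (𝒰.comul_t_mul h a), tMulSnd_tmul, π.hom_t]

theorem coaction_one : π.coaction 1 = 1 ⊗ᵇ 1 := by
  rw [Hom.coaction, LinearMap.comp_apply, 𝒰.comul_one, Hom.idTensor_tmul, map_one]

/-- The coaction as an algebra map to the endomorphisms of `U_◁ ⊗_A ▹V`:
`u` acts by `x ⊗ v ↦ u₍₁₎ x ⊗ π(u₍₂₎) v`. -/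
def coactionEnd : U →ₐ[k] Module.End k (WTensor 𝒰.t 𝒱.s) :=
  AlgHom.ofLinearMap
    { toFun := fun u => WTensor.mulLeft (π.coaction u) (π.isTakeuchi_coaction u)
      map_add' := fun u u' => BalTensor.ext fun x v => by simp [WTensor.mulLeft_tmul]
      map_smul' := fun c u => BalTensor.ext fun x v => by simp [WTensor.mulLeft_tmul] }
    (BalTensor.ext fun x v => by
      simp [WTensor.mulLeft_tmul, coaction_one, WTensor.mulRight_tmul])
    (fun u u' => BalTensor.ext fun x v => by
      obtain ⟨n, y, z, h⟩ := BalTensor.exists_rep (𝒰.comul u)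
      obtain ⟨m, y', z', h'⟩ := BalTensor.exists_rep (𝒰.comul u')
      have h3 : π.coaction (u * u') =
          ∑ i, ∑ j, (y i * y' j) ⊗ᵇ (π.hom (z i) * π.hom (z' j)) := by
        rw [Hom.coaction, LinearMap.comp_apply, 𝒰.comul_mul u u' y z y' z' h h']
        simp [Hom.idTensor_tmul]
      simp only [LinearMap.coe_mk, AddHom.coe_mk, WTensor.mulLeft_tmul, h3, Module.End.mul_apply,
        π.coaction_eq h, π.coaction_eq h', map_sum, WTensor.mulRight_tmul, mul_assoc]
      exact Finset.sum_comm)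

theorem coactionEnd_tmul (u x : U) (v : V) :
    π.coactionEnd u (x ⊗ᵇ v) = WTensor.mulRight 𝒰.t 𝒱.s x v (π.coaction u) :=
  WTensor.mulLeft_tmul _ (π.isTakeuchi_coaction u) x v

theorem coactionEnd_one_tmul_one (u : U) : π.coactionEnd u (1 ⊗ᵇ 1) = π.coaction u := by
  rw [coactionEnd_tmul]
  obtain ⟨n, x, y, h⟩ := BalTensor.exists_rep (π.coaction u)
  simp [h, WTensor.mulRight_tmul]

/-- The tensor product over A is not a ring, so multiplicativity is expressed through the
endomorphism by which u acts; endomorphisms also provide the target ring for the cancellation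
argument. -/
theorem coaction_mul (u u' : U) : π.coaction (u * u') = π.coactionEnd u (π.coaction u') := by
  rw [← coactionEnd_one_tmul_one, map_mul, Module.End.mul_apply, coactionEnd_one_tmul_one]

/-- `x ⊗ v ↦ x₍₁₎ ⊗ (π(x₍₂₎) ⊗ v)`. -/
def coactionId : WTensor 𝒰.t 𝒱.s →ₗ[k] 𝒱.Tensor3 𝒰.t :=
  BalTensor.lift
    (LinearMap.mk₂ k (fun x v => 𝒱.insertRight₃ 𝒰.t v (π.coaction x)) (fun _ _ _ => by simp)
      (fun _ _ _ => by simp)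
      (fun u z z' => by
        obtain ⟨n, x, y, h⟩ := BalTensor.exists_rep (π.coaction u)
        simp [h, EnvRing.insertRight₃_tmul, BalTensor.tmul_add, Finset.sum_add_distrib])
      (fun c u z => by
        obtain ⟨n, x, y, h⟩ := BalTensor.exists_rep (π.coaction u)
        simp [h, EnvRing.insertRight₃_tmul, BalTensor.tmul_smul, Finset.smul_sum]))
    (fun a u z => by
      simp only [LinearMap.mk₂_apply, LinearMap.mulLeft_apply, coaction_t_mul]
      obtain ⟨n, x, y, h⟩ := BalTensor.exists_rep (π.coaction u)
      simp [h, tMulSnd_tmul, EnvRing.insertRight₃_tmul, WTensor.t_mul_tmul])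

theorem coactionId_tmul (x : U) (v : V) :
    π.coactionId (x ⊗ᵇ v) = 𝒱.insertRight₃ 𝒰.t v (π.coaction x) := by
  rw [coactionId, BalTensor.lift_tmul, LinearMap.mk₂_apply]

/-- `x ⊗ v ↦ x ⊗ (v₍₁₎ ⊗ v₍₂₎)`. -/
def idComul (_ : 𝒰.Hom 𝒱) : WTensor 𝒰.t 𝒱.s →ₗ[k] 𝒱.Tensor3 𝒰.t :=
  BalTensor.map LinearMap.id 𝒱.comul (fun _ _ => rfl) (fun a v => 𝒱.comul_leftS a v)

theorem idComul_tmul (x : U) (v : V) : π.idComul (x ⊗ᵇ v) = x ⊗ᵇ 𝒱.comul v := rfl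

/-- Coassociativity of U pushed forward along id ⊗ π ⊗ π. -/
theorem coactionId_coaction (u : U) :
    π.coactionId (π.coaction u) = π.idComul (π.coaction u) := by
  obtain ⟨n, x, y, h⟩ := BalTensor.exists_rep (𝒰.comul u)
  let P : 𝒰.Tensor →ₗ[k] 𝒱.Tensor := BalTensor.map π.hom.toLinearMap π.hom.toLinearMap
    (fun a m => by simp [π.hom_t]) (fun a m => by simp [π.hom_s])
  have hP : ∀ x y, P (x ⊗ᵇ y) = π.hom x ⊗ᵇ π.hom y := fun _ _ => rfl
  let F : 𝒰.Tensor3 𝒰.t →ₗ[k] 𝒱.Tensor3 𝒰.t := BalTensor.map LinearMap.id P (fun _ _ => rfl)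
    (fun a X => by
      obtain ⟨n, x, y, rfl⟩ := BalTensor.exists_rep X
      simp [EnvRing.leftS_tmul, hP, π.hom_s])
  have hF : ∀ x Y, F (x ⊗ᵇ Y) = x ⊗ᵇ P Y := fun _ _ => rfl
  have h1 := congrArg F (𝒰.coassoc_insertRight h)
  have h2 : ∀ z X, F (𝒰.insertRight₃ 𝒰.t z X) = 𝒱.insertRight₃ 𝒰.t (π.hom z) (π.idTensor X) := by
    intro z X
    obtain ⟨n, x, y, rfl⟩ := BalTensor.exists_rep X
    simp [EnvRing.insertRight₃_tmul, hF, hP, Hom.idTensor_tmul]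
  simp only [map_sum, h2, hF] at h1
  rw [π.coaction_eq h]
  simp only [map_sum, coactionId_tmul, idComul_tmul, π.comul_hom]
  exact h1

theorem coaction_counital {u : U} {n : ℕ} {x : Fin n → U} {v : Fin n → V}
    (h : π.coaction u = ∑ i, x i ⊗ᵇ v i) : ∑ i, 𝒰.t (op (𝒱.counit (v i))) * x i = u := by
  let F : WTensor 𝒰.t 𝒱.s →ₗ[k] U := 𝒱.counitRight 𝒰.t
  have hF : ∀ x v, F (x ⊗ᵇ v) = 𝒰.t (op (𝒱.counit v)) * x := fun _ _ => rfl
  obtain ⟨m, x', y', h'⟩ := BalTensor.exists_rep (𝒰.comul u)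
  have h1 := congrArg F ((π.coaction_eq h').symm.trans h)
  simp only [map_sum, hF, π.counit_hom, 𝒰.comul_counit u x' y' h'] at h1
  exact h1.symm

/-- `U` is a right comodule algebra along `π : U → V`. -/
theorem isRightComoduleAlgebra_coaction :
    IsRightComoduleAlgebra 𝒱.toLeftBialgebroid 𝒰.t π.coaction where
  takeuchi := π.isTakeuchi_coaction
  right_linear a r n x y h := by
    rw [coaction_t_mul, h]
    simp [tMulSnd_tmul]
  coassoc r n m x y x' x'' h h' := by
    have := π.coactionId_coaction r
    rw [h] at this
    simpa only [map_sum, coactionId_tmul, idComul_tmul, h', EnvRing.insertRight₃_tmul] using this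
  counital r n x y h := π.coaction_counital h
  mul r r' n m x y x' y' h h' := by
    rw [coaction_mul, h']
    simp only [map_sum, coactionEnd_tmul, h, WTensor.mulRight_tmul]
    exact Finset.sum_comm
  one := π.coaction_one

theorem mem_kernel {u : U} : u ∈ π.kernel ↔ π.coaction u = u ⊗ᵇ 1 := Iff.rfl

theorem kernel_mul_t (b : π.kernel) (a : A) :
    (b : U) * 𝒰.t (op a) = 𝒰.t (op a) * (b : U) := π.mul_t_of_coaction b.2 a

theorem coe_kernelUnit (a : A) : (π.kernelUnit a : U) = 𝒰.s a := rfl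

theorem coaction_kernel_mul (b : π.kernel) {u : U} {n : ℕ} {x : Fin n → U} {v : Fin n → V}
    (h : π.coaction u = ∑ i, x i ⊗ᵇ v i) :
    π.coaction ((b : U) * u) = ∑ i, ((b : U) * x i) ⊗ᵇ v i := by
  rw [coaction_mul, h]
  simp [coactionEnd_tmul, π.mem_kernel.1 b.2, WTensor.mulRight_tmul]

theorem coaction_mul_kernel (b : π.kernel) {u : U} {n : ℕ} {x : Fin n → U} {v : Fin n → V}
    (h : π.coaction u = ∑ i, x i ⊗ᵇ v i) :
    π.coaction (u * (b : U)) = ∑ i, (x i * (b : U)) ⊗ᵇ v i := by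
  rw [coaction_mul, π.mem_kernel.1 b.2, coactionEnd_tmul, h]
  simp [WTensor.mulRight_tmul]

theorem coactionEnd_s (a : A) (x : U) (v : V) :
    π.coactionEnd (𝒰.s a) (x ⊗ᵇ v) = (𝒰.s a * x) ⊗ᵇ v := by
  have : π.coaction (𝒰.s a) = 𝒰.s a ⊗ᵇ 1 := (π.kernelUnit a).2
  rw [coactionEnd_tmul, this, WTensor.mulRight_tmul, one_mul]

theorem coactionEnd_t (a : A) (x : U) (v : V) :
    π.coactionEnd (𝒰.t (op a)) (x ⊗ᵇ v) = x ⊗ᵇ (𝒱.t (op a) * v) := by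
  have := π.coaction_t_mul a 1
  rw [mul_one, coaction_one, tMulSnd_tmul, mul_one] at this
  rw [coactionEnd_tmul, this, WTensor.mulRight_tmul, one_mul]

end LeftHopfAlgebroid.Hom

/-! ### The retraction of U onto the left Hopf kernel -/

namespace LeftHopfAlgebroid

variable {k A U V : Type*} [CommRing k] [Ring A] [Algebra k A]
  [Ring U] [Algebra k U] [Ring V] [Algebra k V]
  {𝒰 : LeftHopfAlgebroid k A U} {𝒱 : LeftHopfAlgebroid k A V}

/-- A unital coring section `γ` of `π` that is linear for the right multiplications by the images
of source and target. -/
structure Hom.IsCleaving (π : 𝒰.Hom 𝒱)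
    (γ : CoringHom 𝒱.toLeftBialgebroid 𝒰.toLeftBialgebroid) : Prop where
  split : ∀ v, π.hom (γ.hom v) = v
  one : γ.hom 1 = 1
  mul_t : ∀ (a : A) (v : V), γ.hom (v * 𝒱.t (op a)) = γ.hom v * 𝒰.t (op a)
  mul_s : ∀ (a : A) (v : V), γ.hom (v * 𝒱.s a) = γ.hom v * 𝒰.s a

section TensorMap

variable {R M N : Type*} [Ring R] [Algebra k R] [AddCommGroup M] [Module k M]
  [AddCommGroup N] [Module k N] {r : A → Module.End k M} {l : A → Module.End k N}

/-- `v ⊗ w ↦ f(v) ⊗ g(w)` on `V_◁ ⊗_A ▹V`. -/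
def tensorMap (f : V →ₗ[k] M) (g : V →ₗ[k] N) (hf : ∀ a v, f (𝒱.t (op a) * v) = r a (f v))
    (hg : ∀ a v, g (𝒱.s a * v) = l a (g v)) : 𝒱.Tensor →ₗ[k] BalTensor r l :=
  BalTensor.map f g hf hg

theorem tensorMap_tmul (f : V →ₗ[k] M) (g : V →ₗ[k] N)
    (hf : ∀ a v, f (𝒱.t (op a) * v) = r a (f v))
    (hg : ∀ a v, g (𝒱.s a * v) = l a (g v)) (v w : V) :
    tensorMap f g hf hg (v ⊗ᵇ w) = (f v ⊗ᵇ g w : BalTensor r l) := rfl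

variable {t : Aᵐᵒᵖ →ₐ[k] R} (f : R →ₗ[k] V →ₗ[k] M) (g : V →ₗ[k] N)
  (hf : ∀ a x v, f x (𝒱.t (op a) * v) = r a (f x v))
  (hf' : ∀ a x v, f (t (op a) * x) v = f x (𝒱.s a * v))
  (hg : ∀ a v, g (𝒱.s a * v) = l a (g v))

/-- `x ⊗ (v ⊗ w) ↦ f(x, v) ⊗ g(w)`. -/
def tensor3Map : 𝒱.Tensor3 t →ₗ[k] BalTensor r l :=
  BalTensor.lift
    (LinearMap.mk₂ k (fun x Y => tensorMap (f x) g (fun a v => hf a x v) hg Y)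
      (fun x x' Y => by
        obtain ⟨n, y, z, rfl⟩ := BalTensor.exists_rep Y
        simp [tensorMap_tmul, BalTensor.add_tmul, Finset.sum_add_distrib])
      (fun c x Y => by
        obtain ⟨n, y, z, rfl⟩ := BalTensor.exists_rep Y
        simp [tensorMap_tmul, BalTensor.smul_tmul, Finset.smul_sum])
      (fun _ _ _ => by simp) (fun _ _ _ => by simp))
    (fun a x Y => by
      obtain ⟨n, y, z, rfl⟩ := BalTensor.exists_rep Y
      simp only [LinearMap.mk₂_apply, map_sum, tensorMap_tmul, EnvRing.leftS_tmul,
        LinearMap.mulLeft_apply, hf'])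

theorem tensor3Map_tmul (x : R) (v w : V) :
    tensor3Map f g hf hf' hg (x ⊗ᵇ (v ⊗ᵇ w)) = (f x v ⊗ᵇ g w : BalTensor r l) := by
  rw [tensor3Map, BalTensor.lift_tmul, LinearMap.mk₂_apply, tensorMap_tmul]

end TensorMap

variable (γ : CoringHom 𝒱.toLeftBialgebroid 𝒰.toLeftBialgebroid)

theorem comul_section {v : V} {n : ℕ} {x y : Fin n → V} (h : 𝒱.comul v = ∑ i, x i ⊗ᵇ y i) :
    𝒰.comul (γ.hom v) = ∑ i, γ.hom (x i) ⊗ᵇ γ.hom (y i) := by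
  rw [γ.comul_hom, h, map_sum]
  rfl

/-- `x ⊗ v ↦ x ⊗ γ(v)`. -/
def idSection : WTensor 𝒰.t 𝒱.s →ₗ[k] 𝒰.Tensor :=
  BalTensor.map LinearMap.id γ.hom (fun _ _ => rfl) (fun a v => γ.hom_s a v)

theorem idSection_tmul (x : U) (v : V) : idSection γ (x ⊗ᵇ v) = x ⊗ᵇ γ.hom v := rfl

/-- `x ⊗ v ↦ x ⊗ (γ(v)₊ ⊗ γ(v)₋)`. -/
def sectionMixed : WTensor 𝒰.t 𝒱.s →ₗ[k] 𝒰.MixedTensor :=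
  𝒰.idTranslation 𝒰.t ∘ₗ idSection γ

theorem sectionMixed_tmul (x : U) (v : V) :
    sectionMixed γ (x ⊗ᵇ v) = x ⊗ᵇ 𝒰.translation (γ.hom v) := rfl

namespace Hom

variable {γ} {π : 𝒰.Hom 𝒱}

theorem IsCleaving.isTakeuchi_idSection (hγ : π.IsCleaving γ) {X : WTensor 𝒰.t 𝒱.s}
    (hX : IsTakeuchi X) : IsTakeuchi (idSection γ X) := by
  intro a
  have h := congrArg (idSection γ) (hX a)
  obtain ⟨n, x, v, rfl⟩ := BalTensor.exists_rep X
  simpa [blackLeft_tmul, blackRight_tmul, idSection_tmul, hγ.mul_s] using h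

/-- Compatibility of γ with right multiplication by s enters here: the Takeuchi condition moves a to
γ(v s(a)) = γ(v) s(a), whose translation is γ(v)₊ s(a) ⊗ γ(v)₋. -/
theorem IsCleaving.mixedMulT_sectionMixed (hγ : π.IsCleaving γ) {X : WTensor 𝒰.t 𝒱.s}
    (hX : IsTakeuchi X) (a : A) :
    𝒰.mixedMulT a (sectionMixed γ X) = 𝒰.mixedMulS a (sectionMixed γ X) := by
  have h := congrArg (sectionMixed γ) (hX a)
  obtain ⟨n, x, v, rfl⟩ := BalTensor.exists_rep X
  simpa [blackLeft_tmul, blackRight_tmul, sectionMixed_tmul, hγ.mul_s, mixedMulT_tmul,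
    mixedMulS_tmul, translation_mul_s] using h

variable (π γ) (D : 𝒰.DualBasis)

/-- The map `u ↦ t(ε(γ(π(u₍₂₎))₊)) u₍₁₎ γ(π(u₍₂₎))₋`. -/
def retraction : U →ₗ[k] U := 𝒰.contract D ∘ₗ sectionMixed γ ∘ₗ π.coaction

theorem retraction_apply (u : U) :
    π.retraction γ D u = 𝒰.contract D (sectionMixed γ (π.coaction u)) := rfl

variable {π γ}

theorem IsCleaving.contracts_iff (hγ : π.IsCleaving γ) {u : U} {X : 𝒰.MixedTensor}
    (hX : X = sectionMixed γ (π.coaction u)) (c : U) :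
    𝒰.Contracts X c ↔ c = π.retraction γ D u := by
  rw [hX, retraction_apply]
  exact 𝒰.contracts_iff D (hγ.mixedMulT_sectionMixed (π.isTakeuchi_coaction u)) c

theorem IsCleaving.retraction_t_mul (hγ : π.IsCleaving γ) (a : A) (u : U) :
    π.retraction γ D (𝒰.t (op a) * u) = π.retraction γ D u * 𝒰.s a := by
  rw [retraction_apply, retraction_apply, ← 𝒰.contract_mixedMulRight D
    (hγ.mixedMulT_sectionMixed (π.isTakeuchi_coaction u)), coaction_t_mul]
  obtain ⟨n, x, v, h⟩ := BalTensor.exists_rep (π.coaction u)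
  simp [h, tMulSnd_tmul, sectionMixed_tmul, γ.hom_t, translation_t_mul, mixedMulRight_tmul]

/-- The factor t(a) on the right of γ(π(u₍₂₎))₋ can be moved to the left of γ(π(u₍₂₎))₊ and then
leaves the counit as t(a) in front. -/
theorem IsCleaving.retraction_mul_t (hγ : π.IsCleaving γ) (a : A) (u : U) :
    π.retraction γ D u * 𝒰.t (op a) = 𝒰.t (op a) * π.retraction γ D u := by
  rw [retraction_apply, ← 𝒰.contract_mixedMulRight D
    (hγ.mixedMulT_sectionMixed (π.isTakeuchi_coaction u)), ← contract_mixedTMul]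
  obtain ⟨n, x, v, h⟩ := BalTensor.exists_rep (π.coaction u)
  simp [h, sectionMixed_tmul, mixedMulRight_tmul, mixedTMul_tmul, opTMul_translation]

theorem retraction_kernel_mul (b : π.kernel) (u : U) :
    π.retraction γ D ((b : U) * u) = b * π.retraction γ D u := by
  rw [retraction_apply, retraction_apply,
    ← 𝒰.contract_mixedMap_one D (b : U) (π.kernel_mul_t b)]
  obtain ⟨n, x, v, h⟩ := BalTensor.exists_rep (π.coaction u)
  simp [h, π.coaction_kernel_mul b h, sectionMixed_tmul, mixedMap_tmul]

/-- `u = φ(u₍₁₎) γ(π(u₍₂₎))` for the retraction `φ`. -/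
theorem IsCleaving.sum_retraction_mul (hγ : π.IsCleaving γ) {u : U} {n : ℕ} {x : Fin n → U}
    {v : Fin n → V} (h : π.coaction u = ∑ i, x i ⊗ᵇ v i) :
    ∑ i, π.retraction γ D (x i) * γ.hom (v i) = u := by
  let P : 𝒱.Tensor →ₗ[k] 𝒰.Tensor := BalTensor.map γ.hom γ.hom
    (fun a m => γ.hom_t (op a) m) (fun a m => γ.hom_s a m)
  have hP : ∀ x y, P (x ⊗ᵇ y) = γ.hom x ⊗ᵇ γ.hom y := fun _ _ => rfl
  -- Q = id ⊗ β⁻¹(γ ⊗ γ) is applied to coassociativity of the coaction. One side contracts to ∑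
  -- φ(xᵢ) γ(vᵢ); on the other β⁻¹ undoes the coproduct and leaves ∑ xᵢ ⊗ γ(vᵢ) ⊗ 1, which contracts
  -- to u.
  let Q : 𝒱.Tensor3 𝒰.t →ₗ[k] 𝒰.MixedTensor := BalTensor.map LinearMap.id
    (𝒰.galois.symm.toLinearMap ∘ₗ P) (fun _ _ => rfl) (fun a X => by
      apply 𝒰.galois.injective
      obtain ⟨n, x, y, rfl⟩ := BalTensor.exists_rep X
      simp [galois_opLeftS, hP, EnvRing.leftS_tmul, γ.hom_s])
  have hQ : ∀ x Y, Q (x ⊗ᵇ Y) = x ⊗ᵇ 𝒰.galois.symm (P Y) := fun _ _ => rfl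
  have h1 : ∀ w X, Q (𝒱.insertRight₃ 𝒰.t w X) =
      𝒰.mixedMulRight (γ.hom w) (sectionMixed γ X) := by
    intro w X
    obtain ⟨n, x, y, rfl⟩ := BalTensor.exists_rep X
    simp [EnvRing.insertRight₃_tmul, hQ, hP, galois_symm_tmul, sectionMixed_tmul,
      mixedMulRight_tmul]
  have h2 : ∀ x w, Q (x ⊗ᵇ 𝒱.comul w) = x ⊗ᵇ (γ.hom w ⊗ᵇ 1) := by
    intro x w
    rw [hQ, ← galois_symm_comul, γ.comul_hom]
  have h3 := congrArg Q (π.coactionId_coaction u)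
  simp only [h, map_sum, coactionId_tmul, idComul_tmul, h1, h2] at h3
  have h4 : ∑ i, x i ⊗ᵇ (γ.hom (v i) ⊗ᵇ 1) =
      𝒰.insertRight 𝒰.t 1 (idSection γ (π.coaction u)) := by
    simp [h, idSection_tmul, EnvRing.insertRight_tmul]
  have h5 : ∀ i, π.retraction γ D (x i) * γ.hom (v i) =
      𝒰.contract D (𝒰.mixedMulRight (γ.hom (v i)) (sectionMixed γ (π.coaction (x i)))) := by
    intro i
    rw [𝒰.contract_mixedMulRight D
      (hγ.mixedMulT_sectionMixed (π.isTakeuchi_coaction _)), retraction_apply]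
  simp only [h5]
  rw [← map_sum, h3, h4, contract_insertRight _ _
    (hγ.isTakeuchi_idSection (π.isTakeuchi_coaction u)), h]
  simp only [map_sum, idSection_tmul, LeftBialgebroid.counitRight_tmul, γ.counit_hom, mul_one]
  exact π.coaction_counital h

theorem IsCleaving.coaction_section (hγ : π.IsCleaving γ) {v : V} {n : ℕ} {x y : Fin n → V}
    (h : 𝒱.comul v = ∑ i, x i ⊗ᵇ y i) :
    π.coaction (γ.hom v) = ∑ i, γ.hom (x i) ⊗ᵇ y i := by
  rw [π.coaction_eq (comul_section γ h)]
  simp [hγ.split]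

/-- `φ(γ(v) b) = γ(v)₊ b γ(v)₋` for the retraction `φ`. -/
theorem IsCleaving.retraction_section_mul (hγ : π.IsCleaving γ) (v : V) (b : π.kernel) :
    π.retraction γ D (γ.hom v * b) =
      𝒰.sandwich (AlgHom.id k U) b (π.kernel_mul_t b) (𝒰.translation (γ.hom v)) := by
  have := 𝒰.contraction_mixedMap_idTranslation D 𝒰.id_t 1 (b : U) (fun _ => by simp)
    (π.kernel_mul_t b) (γ.hom v)
  rw [one_mul] at this
  rw [← this, retraction_apply, contract]
  obtain ⟨n, x, y, h⟩ := BalTensor.exists_rep (𝒱.comul v)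
  rw [π.coaction_mul_kernel b (hγ.coaction_section h), comul_section γ h]
  simp only [map_sum, sectionMixed_tmul, idTranslation_tmul, mixedMap_tmul, AlgHom.id_apply,
    one_mul]

theorem IsCleaving.retraction_section (hγ : π.IsCleaving γ) (v : V) :
    π.retraction γ D (γ.hom v) = 𝒰.s (𝒱.counit v) := by
  have h := hγ.retraction_section_mul D v 1
  have hs := 𝒰.sandwich_one_translation (AlgHom.id k U) (γ.hom v)
  rw [← mul_one (γ.hom v), ← γ.counit_hom]
  exact h.trans hs

/-- Cancellation of `γ` in `d(u₍₁₎) γ(π(u₍₂₎)) = 0`. -/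
theorem eq_zero_of_sum_mul_section {R : Type*} [Ring R] [Algebra k R]
    (D : 𝒰.DualBasis) (ρ : U →ₐ[k] R) (d : U →ₗ[k] R)
    (hs : ∀ a u, d (𝒰.t (op a) * u) = d u * ρ (𝒰.s a))
    (ht : ∀ a u, d u * ρ (𝒰.t (op a)) = ρ (𝒰.t (op a)) * d u)
    (hd : ∀ (u : U) {n : ℕ} (x : Fin n → U) (v : Fin n → V), π.coaction u = ∑ i, x i ⊗ᵇ v i →
      ∑ i, d (x i) * ρ (γ.hom (v i)) = 0) : d = 0 := by
  obtain ⟨t, htρ⟩ : ∃ t : Aᵐᵒᵖ →ₐ[k] R, ∀ a, ρ (𝒰.t a) = t a := ⟨ρ.comp 𝒰.t, fun _ => rfl⟩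
  have ht' : ∀ x a, d x * t (op a) = t (op a) * d x := fun x a => by rw [← htρ, ht]
  -- Q sends x ⊗ v ⊗ w to d(x) ρ(γ(v)) ⊗ γ(w)₊ ⊗ γ(w)₋. By coassociativity the hypothesis makes ∑
  -- d(xᵢ) ρ(γ(vᵢ)₍₁₎) ⊗ γ(vᵢ)₍₂₎₊ ⊗ γ(vᵢ)₍₂₎₋ vanish. Its contraction is ∑ d(xᵢ) ρ(s(ε(vᵢ))) = d(∑
  -- t(ε(vᵢ)) xᵢ) = d(u).
  let Q : 𝒱.Tensor3 𝒰.t →ₗ[k] 𝒰.MixedOver t :=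
    tensor3Map ((LinearMap.mul k R).compl₁₂ d (ρ.toLinearMap ∘ₗ γ.hom)) (𝒰.translationL ∘ₗ γ.hom)
      (fun a x v => by simp [γ.hom_t, ← mul_assoc, htρ, ht'])
      (fun a x v => by simp [γ.hom_s, hs, mul_assoc])
      (fun a v => by simp [translationL_apply, γ.hom_s, translation_s_mul])
  have hQ : ∀ x v w, Q (x ⊗ᵇ (v ⊗ᵇ w)) = (d x * ρ (γ.hom v)) ⊗ᵇ 𝒰.translation (γ.hom w) :=
    fun x v w => tensor3Map_tmul _ _ _ _ _ x v w
  ext u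
  obtain ⟨n, x, v, h⟩ := BalTensor.exists_rep (π.coaction u)
  have h1 : ∀ x w, Q (𝒱.insertRight₃ 𝒰.t w (π.coaction x)) = 0 := by
    intro x w
    obtain ⟨m, y, z, h'⟩ := BalTensor.exists_rep (π.coaction x)
    simp only [h', map_sum, EnvRing.insertRight₃_tmul, hQ]
    rw [← BalTensor.sum_tmul, hd x y z h', BalTensor.zero_tmul]
  have h2 : ∀ x w, Q (x ⊗ᵇ 𝒱.comul w) = 𝒰.mixedMap htρ (d x) 1 (ht' x)
      (𝒰.idTranslation 𝒰.t (𝒰.comul (γ.hom w))) := by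
    intro x w
    obtain ⟨m, y, z, h'⟩ := BalTensor.exists_rep (𝒱.comul w)
    simp [comul_section γ h', h', BalTensor.tmul_sum, hQ, idTranslation_tmul, mixedMap_tmul]
  have h3 := congrArg Q (π.coactionId_coaction u)
  simp only [h, map_sum, coactionId_tmul, idComul_tmul, h1, h2, Finset.sum_const_zero] at h3
  have h4 := congrArg (𝒰.contraction D htρ) h3
  simp only [map_sum, map_zero, 𝒰.contraction_mixedMap_idTranslation D htρ _ 1 _
    (fun _ => by simp), sandwich_one_translation, γ.counit_hom, ← hs] at h4
  rw [← map_sum, π.coaction_counital h] at h4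
  exact h4.symm

/-- The defect d(u) between the action of φ(u) through the coaction and multiplication by φ(u) on
the first factor satisfies the cancellation hypotheses, with ρ = `coactionEnd`. Indeed both terms,
multiplied by γ(π(u₍₂₎)) and summed, give the action of u. -/
theorem IsCleaving.retraction_mem (hγ : π.IsCleaving γ) (u : U) :
    π.retraction γ D u ∈ π.kernel := by
  let L : U →ₗ[k] Module.End k (WTensor 𝒰.t 𝒱.s) :=
    { toFun := fun u => BalTensor.map (LinearMap.mulLeft k (π.retraction γ D u)) LinearMap.id
        (fun a m => by simp [← mul_assoc, hγ.retraction_mul_t]) (fun _ _ => rfl)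
      map_add' := fun u u' => BalTensor.ext fun x v => by
        rw [LinearMap.add_apply, BalTensor.map_tmul, BalTensor.map_tmul, BalTensor.map_tmul]
        simp [add_mul, BalTensor.add_tmul]
      map_smul' := fun c u => BalTensor.ext fun x v => by
        rw [LinearMap.smul_apply, BalTensor.map_tmul, BalTensor.map_tmul]
        simp [BalTensor.smul_tmul] }
  have hL : ∀ u x v, L u (x ⊗ᵇ v) = (π.retraction γ D u * x) ⊗ᵇ v := fun _ _ _ => rfl
  let d := π.coactionEnd.toLinearMap ∘ₗ π.retraction γ D - L
  have hd : ∀ u, d u = π.coactionEnd (π.retraction γ D u) - L u := fun _ => rfl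
  have h0 : d = 0 := by
    refine eq_zero_of_sum_mul_section (π := π) (γ := γ) D π.coactionEnd d (fun a u => ?_)
      (fun a u => ?_) (fun u n x v h => ?_)
    · rw [hd, hd, hγ.retraction_t_mul, map_mul, sub_mul]
      congr 1
      exact BalTensor.ext fun x v => by
        simp [hL, coactionEnd_s, hγ.retraction_t_mul, mul_assoc]
    · rw [hd, sub_mul, mul_sub, ← map_mul, ← map_mul, hγ.retraction_mul_t]
      congr 1
      exact BalTensor.ext fun x v => by simp [hL, coactionEnd_t]
    · simp only [hd, sub_mul, Finset.sum_sub_distrib, ← map_mul]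
      rw [← map_sum, hγ.sum_retraction_mul D h, sub_eq_zero]
      -- Q sends x ⊗ v ⊗ w to φ(x) γ(v) ⊗ w. Coassociativity and reconstruction identify ∑ φ(xᵢ)
      -- γ(vᵢ₍₁₎) ⊗ vᵢ₍₂₎ with the coaction of u.
      let Q : 𝒱.Tensor3 𝒰.t →ₗ[k] WTensor 𝒰.t 𝒱.s :=
        tensor3Map ((LinearMap.mul k U).compl₁₂ (π.retraction γ D) γ.hom) LinearMap.id
          (fun a x v => by simp [γ.hom_t, ← mul_assoc, hγ.retraction_mul_t])
          (fun a x v => by simp [γ.hom_s, hγ.retraction_t_mul, mul_assoc])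
          (fun _ _ => rfl)
      have hQ : ∀ x v w, Q (x ⊗ᵇ (v ⊗ᵇ w)) = (π.retraction γ D x * γ.hom v) ⊗ᵇ w :=
        fun x v w => tensor3Map_tmul _ _ _ _ _ x v w
      have h1 : ∀ x w, Q (𝒱.insertRight₃ 𝒰.t w (π.coaction x)) = x ⊗ᵇ w := by
        intro x w
        obtain ⟨m, y, z, h'⟩ := BalTensor.exists_rep (π.coaction x)
        simp only [h', map_sum, EnvRing.insertRight₃_tmul, hQ]
        rw [← BalTensor.sum_tmul, hγ.sum_retraction_mul D h']
      have h2 : ∀ x w, Q (x ⊗ᵇ 𝒱.comul w) = L x (π.coaction (γ.hom w)) := by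
        intro x w
        obtain ⟨m, y, z, h'⟩ := BalTensor.exists_rep (𝒱.comul w)
        simp [hγ.coaction_section h', h', BalTensor.tmul_sum, hQ, hL]
      have h3 := congrArg Q (π.coactionId_coaction u)
      simp only [h, map_sum, coactionId_tmul, idComul_tmul, h1, h2] at h3
      -- Both endomorphisms commute with right multiplications, so it suffices to compare them on 1
      -- ⊗ 1.
      have hLm : ∀ u y w X, L u (WTensor.mulRight 𝒰.t 𝒱.s y w X) =
          WTensor.mulRight 𝒰.t 𝒱.s y w (L u X) := by
        intro u y w X
        obtain ⟨m, x', z, rfl⟩ := BalTensor.exists_rep X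
        simp [hL, WTensor.mulRight_tmul, mul_assoc]
      refine BalTensor.ext fun y w => ?_
      simp only [LinearMap.sum_apply, Module.End.mul_apply, coactionEnd_tmul, hLm]
      rw [← map_sum, ← h3, ← h]
  have h1 := hd u
  rw [h0, LinearMap.zero_apply, eq_comm, sub_eq_zero] at h1
  rw [mem_kernel, ← coactionEnd_one_tmul_one, h1, hL, mul_one]

end Hom

end LeftHopfAlgebroid

/-! ### Transport of comodule algebras along an isomorphism -/

section Transport

variable {k A R R' V : Type*} [CommRing k] [Ring A] [Algebra k A] [Ring R] [Algebra k R]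
  [Ring R'] [Algebra k R'] [Ring V] [Algebra k V]

/-- `f ⊗_A id : R_◁ ⊗_A ▹V → R'_◁ ⊗_A ▹V` for an algebra map `f` compatible with targets. -/
def WTensor.mapFst {t : Aᵐᵒᵖ →ₐ[k] R} {t' : Aᵐᵒᵖ →ₐ[k] R'} (s : A →ₐ[k] V) (f : R →ₐ[k] R')
    (hf : ∀ a, f (t a) = t' a) : WTensor t s →ₗ[k] WTensor t' s :=
  BalTensor.map f.toLinearMap LinearMap.id (fun a m => by simp [hf]) (fun _ _ => rfl)

theorem WTensor.mapFst_tmul {t : Aᵐᵒᵖ →ₐ[k] R} {t' : Aᵐᵒᵖ →ₐ[k] R'} (s : A →ₐ[k] V)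
    (f : R →ₐ[k] R') (hf : ∀ a, f (t a) = t' a) (x : R) (v : V) :
    WTensor.mapFst s f hf (x ⊗ᵇ v) = f x ⊗ᵇ v := rfl

variable (e : R ≃ₐ[k] R') {t : Aᵐᵒᵖ →ₐ[k] R} {t' : Aᵐᵒᵖ →ₐ[k] R'} (he : ∀ a, e (t a) = t' a)

theorem symm_target (he : ∀ a, e (t a) = t' a) (a : Aᵐᵒᵖ) : (e.symm : R' →ₐ[k] R) (t' a) = t a := by simp [← he]

/-- A coaction on `R'`, transported to `R` along an isomorphism. -/
def transportCoaction (s : A →ₐ[k] V) (δ : R' →ₗ[k] WTensor t' s) : R →ₗ[k] WTensor t s :=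
  WTensor.mapFst s (e.symm : R' →ₐ[k] R) (symm_target e he) ∘ₗ δ ∘ₗ e.toLinearMap

theorem eq_sum_of_transportCoaction (s : A →ₐ[k] V) (δ : R' →ₗ[k] WTensor t' s) {r : R} {n : ℕ}
    {x : Fin n → R} {y : Fin n → V} (h : transportCoaction e he s δ r = ∑ i, x i ⊗ᵇ y i) :
    δ (e r) = ∑ i, e (x i) ⊗ᵇ y i := by
  have he' : ∀ a, (e : R →ₐ[k] R') (t a) = t' a := he
  have h1 := congrArg (WTensor.mapFst s (e : R →ₐ[k] R') he') h
  obtain ⟨m, x', y', h'⟩ := BalTensor.exists_rep (δ (e r))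
  simp only [transportCoaction, LinearMap.comp_apply, AlgEquiv.toLinearMap_apply, h', map_sum,
    WTensor.mapFst_tmul, AlgEquiv.coe_toAlgHom, AlgEquiv.apply_symm_apply] at h1
  rw [h', h1]

theorem transportCoaction_eq_sum (s : A →ₐ[k] V) (δ : R' →ₗ[k] WTensor t' s) {r : R} {n : ℕ}
    {x : Fin n → R'} {y : Fin n → V} (h : δ (e r) = ∑ i, x i ⊗ᵇ y i) :
    transportCoaction e he s δ r = ∑ i, e.symm (x i) ⊗ᵇ y i := by
  simp [transportCoaction, h, WTensor.mapFst_tmul]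

theorem IsRightComoduleAlgebra.transport {𝒱 : LeftBialgebroid k A V}
    {δ : R' →ₗ[k] WTensor t' 𝒱.s} (h : IsRightComoduleAlgebra 𝒱 t' δ) :
    IsRightComoduleAlgebra 𝒱 t (transportCoaction e he 𝒱.s δ) where
  takeuchi r a := by
    obtain ⟨n, x, y, h'⟩ := BalTensor.exists_rep (δ (e r))
    have := congrArg (WTensor.mapFst 𝒱.s (e.symm : R' →ₐ[k] R) (symm_target e he))
      (h.takeuchi (e r) a)
    rw [transportCoaction_eq_sum e he _ _ h']
    simpa [h', blackLeft_tmul, blackRight_tmul, WTensor.mapFst_tmul, ← he] using this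
  right_linear a r n x y h' := by
    have h1 := h.right_linear a (e r) _ _ (eq_sum_of_transportCoaction e he _ _ h')
    rw [← he, ← map_mul] at h1
    simpa using transportCoaction_eq_sum e he _ _ h1
  coassoc r n m x y x' x'' h' h'' := by
    have h1 := h.coassoc (e r) _ _ _ _ (eq_sum_of_transportCoaction e he _ _ h')
      (fun i => eq_sum_of_transportCoaction e he _ _ (h'' i))
    let F : 𝒱.Tensor3 t' →ₗ[k] 𝒱.Tensor3 t := BalTensor.map e.symm.toLinearMap LinearMap.id
      (fun a m => by simp [← he]) (fun _ _ => rfl)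
    have hF : ∀ x Y, F (x ⊗ᵇ Y) = e.symm x ⊗ᵇ Y := fun _ _ => rfl
    simpa [hF] using congrArg F h1
  counital r n x y h' := by
    apply e.injective
    simpa [he] using h.counital (e r) _ _ (eq_sum_of_transportCoaction e he _ _ h')
  mul r r' n m x y x' y' h1 h2 := by
    have h3 := h.mul (e r) (e r') _ _ _ _ (eq_sum_of_transportCoaction e he _ _ h1)
      (eq_sum_of_transportCoaction e he _ _ h2)
    simp [transportCoaction, h3, WTensor.mapFst_tmul]
  one := by
    simp [transportCoaction, h.one, WTensor.mapFst_tmul]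

end Transport

/-! ### Weak action, cocycle and crossed product -/

namespace LeftHopfAlgebroid.Hom

variable {k A U V : Type*} [CommRing k] [Ring A] [Algebra k A]
  [Ring U] [Algebra k U] [Ring V] [Algebra k V]
  {𝒰 : LeftHopfAlgebroid k A U} {𝒱 : LeftHopfAlgebroid k A V}
  {γ : CoringHom 𝒱.toLeftBialgebroid 𝒰.toLeftBialgebroid} {π : 𝒰.Hom 𝒱}

variable (π γ) in
/-- `b ⊗ v ↦ b γ(v)`. -/
def mulSection : BTensor 𝒱.toLeftBialgebroid π.kernelUnit →ₗ[k] U :=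
  BalTensor.lift ((LinearMap.mul k U).compl₁₂ π.kernel.val.toLinearMap γ.hom)
    (fun a b v => by simp [γ.hom_s, coe_kernelUnit, mul_assoc])

theorem mulSection_tmul (b : π.kernel) (v : V) : π.mulSection γ (b ⊗ᵇ v) = b * γ.hom v := rfl

namespace IsCleaving

variable (hγ : π.IsCleaving γ) (D : 𝒰.DualBasis)

/-- The retraction of `U` onto the left Hopf kernel of `π`. -/
def toKernel : U →ₗ[k] π.kernel :=
  (π.retraction γ D).codRestrict (Subalgebra.toSubmodule π.kernel) (hγ.retraction_mem D)

theorem coe_toKernel (u : U) : (hγ.toKernel D u : U) = π.retraction γ D u := rfl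

theorem toKernel_kernel_mul (b : π.kernel) (u : U) :
    hγ.toKernel D (b * u) = b * hγ.toKernel D u :=
  Subtype.ext (retraction_kernel_mul D b u)

theorem toKernel_s_mul (a : A) (u : U) :
    hγ.toKernel D (𝒰.s a * u) = π.kernelUnit a * hγ.toKernel D u :=
  hγ.toKernel_kernel_mul D (π.kernelUnit a) u

theorem toKernel_t_mul (a : A) (u : U) :
    hγ.toKernel D (𝒰.t (op a) * u) = hγ.toKernel D u * π.kernelUnit a :=
  Subtype.ext (hγ.retraction_t_mul D a u)

theorem toKernel_section (v : V) :
    hγ.toKernel D (γ.hom v) = π.kernelUnit (𝒱.counit v) :=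
  Subtype.ext (hγ.retraction_section D v)

/-- `x ⊗ v ↦ φ(x) γ(v)` for the retraction `φ`. -/
def retractionMul : WTensor 𝒰.t 𝒱.s →ₗ[k] U :=
  BalTensor.lift ((LinearMap.mul k U).compl₁₂ (π.retraction γ D) γ.hom)
    (fun a x v => by simp [hγ.retraction_t_mul, γ.hom_s, mul_assoc])

theorem retractionMul_tmul (x : U) (v : V) :
    hγ.retractionMul D (x ⊗ᵇ v) = hγ.toKernel D x * γ.hom v := rfl

theorem retractionMul_coaction (u : U) : hγ.retractionMul D (π.coaction u) = u := by
  obtain ⟨n, x, v, h⟩ := BalTensor.exists_rep (π.coaction u)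
  simpa [h, retractionMul_tmul, coe_toKernel] using hγ.sum_retraction_mul D h

theorem coaction_section_mul_section (hγ : π.IsCleaving γ) {v w : V} {n m : ℕ} {x y : Fin n → V}
    {x' y' : Fin m → V} (h : 𝒱.comul v = ∑ i, x i ⊗ᵇ y i) (h' : 𝒱.comul w = ∑ j, x' j ⊗ᵇ y' j) :
    π.coaction (γ.hom v * γ.hom w) =
      ∑ i, ∑ j, (γ.hom (x i) * γ.hom (x' j)) ⊗ᵇ (y i * y' j) :=
  π.isRightComoduleAlgebra_coaction.mul _ _ _ _ _ _ (hγ.coaction_section h)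
    (hγ.coaction_section h')

/-- Reconstruction applied to γ(v) b, whose coaction is γ(v₍₁₎) b ⊗ v₍₂₎: it reads γ(v) b = (v₍₁₎ ▷
b) γ(v₍₂₎). -/
theorem section_mul_kernel {v : V} {n : ℕ} {x y : Fin n → V} (h : 𝒱.comul v = ∑ i, x i ⊗ᵇ y i)
    (b : π.kernel) :
    γ.hom v * b = ∑ i, (hγ.toKernel D (γ.hom (x i) * b) : U) * γ.hom (y i) := by
  conv_lhs => rw [← hγ.retractionMul_coaction D (γ.hom v * b),
    π.coaction_mul_kernel b (hγ.coaction_section h)]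
  simp only [map_sum, retractionMul_tmul]

/-- Reconstruction applied to γ(v) γ(w): it reads γ(v) γ(w) = σ(v₍₁₎, w₍₁₎) γ(v₍₂₎ w₍₂₎). -/
theorem section_mul_section {v w : V} {n m : ℕ} {x y : Fin n → V}
    {x' y' : Fin m → V} (h : 𝒱.comul v = ∑ i, x i ⊗ᵇ y i) (h' : 𝒱.comul w = ∑ j, x' j ⊗ᵇ y' j) :
    γ.hom v * γ.hom w = ∑ i, ∑ j,
      (hγ.toKernel D (γ.hom (x i) * γ.hom (x' j)) : U) * γ.hom (y i * y' j) := by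
  conv_lhs => rw [← hγ.retractionMul_coaction D (γ.hom v * γ.hom w),
    hγ.coaction_section_mul_section h h']
  simp only [map_sum, retractionMul_tmul]

theorem toKernel_section_mul_kernel_mul {v : V} {n : ℕ} {x y : Fin n → V}
    (h : 𝒱.comul v = ∑ i, x i ⊗ᵇ y i) (b : π.kernel) (u : U) :
    hγ.toKernel D (γ.hom v * (b * u)) =
      ∑ i, hγ.toKernel D (γ.hom (x i) * b) * hγ.toKernel D (γ.hom (y i) * u) := by
  rw [← mul_assoc, hγ.section_mul_kernel D h, Finset.sum_mul, map_sum]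
  simp only [mul_assoc, toKernel_kernel_mul]

theorem toKernel_section_mul_section_mul {v w : V} {n m : ℕ} {x y : Fin n → V}
    {x' y' : Fin m → V} (h : 𝒱.comul v = ∑ i, x i ⊗ᵇ y i) (h' : 𝒱.comul w = ∑ j, x' j ⊗ᵇ y' j)
    (u : U) :
    hγ.toKernel D (γ.hom v * γ.hom w * u) = ∑ i, ∑ j,
      hγ.toKernel D (γ.hom (x i) * γ.hom (x' j)) * hγ.toKernel D (γ.hom (y i * y' j) * u) := by
  rw [hγ.section_mul_section D h h']
  simp only [Finset.sum_mul, map_sum, mul_assoc, toKernel_kernel_mul]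

/-- The weak action `v ▷ b = φ(γ(v) b)` on the left Hopf kernel. -/
def measuring : Measuring 𝒱.toLeftBialgebroid π.kernelUnit where
  act := LinearMap.mk₂ k (fun v b => hγ.toKernel D (γ.hom v * b))
    (fun _ _ _ => by simp [add_mul]) (fun _ _ _ => by simp)
    (fun _ _ _ => by simp [mul_add]) (fun _ _ _ => by simp)
  act_white a a' v b := by
    simp only [LinearMap.mk₂_apply, mul_assoc, γ.hom_s, γ.hom_t, toKernel_s_mul, toKernel_t_mul]
  act_one v := by
    simp only [LinearMap.mk₂_apply, OneMemClass.coe_one, mul_one, toKernel_section]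
  act_mul v b b' n x y h := by
    simp only [LinearMap.mk₂_apply, MulMemClass.coe_mul]
    exact hγ.toKernel_section_mul_kernel_mul D h b b'

theorem measuring_act (v : V) (b : π.kernel) :
    (hγ.measuring D).act v b = hγ.toKernel D (γ.hom v * b) := rfl

/-- The cocycle `σ(v, w) = φ(γ(v) γ(w))`. -/
def cocycle : 𝒱.OpTensor →ₗ[k] π.kernel :=
  BalTensor.lift (((LinearMap.mul k U).compl₁₂ γ.hom γ.hom).compr₂ (hγ.toKernel D))
    (fun a v w => by
      have := γ.hom_t (op a) w
      simp [hγ.mul_t, this, mul_assoc])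

theorem cocycle_tmul (v w : V) :
    hγ.cocycle D (v ⊗ᵇ w) = hγ.toKernel D (γ.hom v * γ.hom w) := rfl

/-- The cocycle identity evaluates φ(γ(u) γ(v) γ(w)) in two ways, combining either the last two or
the first two factors. Twisted associativity does the same for φ(γ(u) γ(v) b). -/
theorem isTwistedModule : IsTwistedModule (hγ.measuring D) (hγ.cocycle D) where
  white a a' v w := by
    simp only [cocycle_tmul, mul_assoc, γ.hom_s, γ.hom_t, toKernel_s_mul, toKernel_t_mul]
  act_unit a u v n x y h := by
    have := hγ.toKernel_section_mul_kernel_mul D h (π.kernelUnit a) (γ.hom v)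
    rw [coe_kernelUnit, ← γ.hom_s] at this
    simp only [cocycle_tmul, measuring_act, this, coe_kernelUnit]
  one_left u := by rw [cocycle_tmul, hγ.one, one_mul, toKernel_section]
  one_right u := by rw [cocycle_tmul, hγ.one, mul_one, toKernel_section]
  cocycle u v w n m l x y x' y' x'' y'' hu hv hw := by
    simp only [cocycle_tmul, measuring_act]
    rw [← hγ.toKernel_section_mul_section_mul D hu hv, mul_assoc, hγ.section_mul_section D hv hw]
    simp only [Finset.mul_sum, map_sum, hγ.toKernel_section_mul_kernel_mul D hu]
    rw [Finset.sum_comm]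
    exact Finset.sum_congr rfl fun j _ => Finset.sum_comm
  one_act b := by
    rw [measuring_act, hγ.one]
    -- φ fixes B: φ(b) = b φ(1), and φ(1) = φ(γ(1)) = s(ε(1)) = 1.
    have := hγ.toKernel_kernel_mul D b 1
    rw [← hγ.one, toKernel_section, 𝒱.counit_one, map_one π.kernelUnit, mul_one, hγ.one,
      mul_one] at this
    rw [one_mul, this]
  twisted u v b n m x y x' y' hu hv := by
    simp only [cocycle_tmul, measuring_act]
    rw [← hγ.toKernel_section_mul_section_mul D hu hv, mul_assoc, hγ.section_mul_kernel D hv]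
    simp only [Finset.mul_sum, map_sum, hγ.toKernel_section_mul_kernel_mul D hu]
    exact Finset.sum_comm

/-- `x ⊗ v ↦ φ(x) ⊗ v`. -/
def toKernelTensor : WTensor 𝒰.t 𝒱.s →ₗ[k] BTensor 𝒱.toLeftBialgebroid π.kernelUnit :=
  BalTensor.map (hγ.toKernel D) LinearMap.id (fun a x => hγ.toKernel_t_mul D a x)
    (fun _ _ => rfl)

theorem toKernelTensor_tmul (x : U) (v : V) :
    hγ.toKernelTensor D (x ⊗ᵇ v) = hγ.toKernel D x ⊗ᵇ v := rfl

/-- The linear isomorphism `B ⊗_A V ≃ U`, `b ⊗ v ↦ b γ(v)`. -/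
def tensorEquiv : BTensor 𝒱.toLeftBialgebroid π.kernelUnit ≃ₗ[k] U :=
  LinearEquiv.ofLinearMap (π.mulSection γ) (hγ.toKernelTensor D ∘ₗ π.coaction)
    (by
      ext u
      obtain ⟨n, x, v, h⟩ := BalTensor.exists_rep (π.coaction u)
      simpa [h, toKernelTensor_tmul, mulSection_tmul, coe_toKernel] using hγ.sum_retraction_mul D h)
    (BalTensor.ext fun b v => by
      obtain ⟨n, x, y, h⟩ := BalTensor.exists_rep (𝒱.comul v)
      have h1 : ∀ x y : V, ((b * π.kernelUnit (𝒱.counit x)) ⊗ᵇ y :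
          BTensor 𝒱.toLeftBialgebroid π.kernelUnit) = b ⊗ᵇ (𝒱.s (𝒱.counit x) * y) :=
        fun x y => BalTensor.act_tmul (r := fun a : A => LinearMap.mulRight k (π.kernelUnit a))
          (l := fun a : A => LinearMap.mulLeft k (𝒱.s a)) (𝒱.counit x) b y
      -- φ(b γ(v₍₁₎)) ⊗ v₍₂₎ = b s(ε(v₍₁₎)) ⊗ v₍₂₎ = b ⊗ s(ε(v₍₁₎)) v₍₂₎ = b ⊗ v.
      rw [LinearMap.comp_apply, LinearMap.comp_apply, mulSection_tmul,
        π.coaction_kernel_mul b (hγ.coaction_section h), map_sum]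
      simp only [toKernelTensor_tmul, toKernel_kernel_mul, toKernel_section, h1]
      rw [← BalTensor.tmul_sum, 𝒱.counit_comul v x y h, LinearMap.id_apply])

theorem tensorEquiv_tmul (b : π.kernel) (v : V) :
    hγ.tensorEquiv D (b ⊗ᵇ v) = b * γ.hom v := rfl

theorem tensorEquiv_symm {u : U} {n : ℕ} {x : Fin n → U} {v : Fin n → V}
    (h : π.coaction u = ∑ i, x i ⊗ᵇ v i) :
    (hγ.tensorEquiv D).symm u = ∑ i, hγ.toKernel D (x i) ⊗ᵇ v i := by
  change hγ.toKernelTensor D (π.coaction u) = _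
  simp only [h, map_sum, toKernelTensor_tmul]

/-- The crossed product multiplication on `B ⊗_A V`, transported from `U`. -/
def crossedProduct : CrossedProduct (hγ.measuring D) (hγ.cocycle D) where
  mul := ((LinearMap.mul k U).compl₁₂ (hγ.tensorEquiv D).toLinearMap
    (hγ.tensorEquiv D).toLinearMap).compr₂ (hγ.tensorEquiv D).symm.toLinearMap
  mul_tmul b b' v w n m l v₁ v₂₃ v₂ v₃ w₁ w₂ hv hv₂₃ hw := by
    simp only [LinearMap.compr₂_apply, LinearMap.compl₁₂_apply, LinearEquiv.coe_coe,
      LinearMap.mul_apply']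
    rw [LinearEquiv.symm_apply_eq]
    simp only [map_sum, tensorEquiv_tmul, cocycle_tmul, measuring_act, MulMemClass.coe_mul]
    -- In U, the product b γ(v) b' γ(w) is rewritten by moving γ(v) past b' and then merging γ(v₍₂₎)
    -- with γ(w).
    rw [mul_assoc, ← mul_assoc (γ.hom v), hγ.section_mul_kernel D hv, Finset.sum_mul,
      Finset.mul_sum]
    refine Finset.sum_congr rfl fun i _ => ?_
    rw [mul_assoc, hγ.section_mul_section D (hv₂₃ i) hw]
    simp only [Finset.mul_sum, mul_assoc]
  mul_assoc x y z := by simp [mul_assoc]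
  one_mul x := by simp [tensorEquiv_tmul, hγ.one]
  mul_one x := by simp [tensorEquiv_tmul, hγ.one]

theorem tensorEquiv_mul (x y : BTensor 𝒱.toLeftBialgebroid π.kernelUnit) :
    hγ.tensorEquiv D ((hγ.crossedProduct D).mul x y) =
      hγ.tensorEquiv D x * hγ.tensorEquiv D y :=
  (hγ.tensorEquiv D).apply_symm_apply _

/-- The algebra isomorphism `B #_σ V ≃ U`, `b # v ↦ b γ(v)`. -/
def crossedEquiv : (hγ.crossedProduct D).Carrier ≃ₐ[k] U :=
  AlgEquiv.ofLinearEquiv (R := k) (A₁ := (hγ.crossedProduct D).Carrier) (hγ.tensorEquiv D)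
    (by
      change hγ.tensorEquiv D (1 ⊗ᵇ 1) = 1
      simp [tensorEquiv_tmul, hγ.one])
    (fun x y => hγ.tensorEquiv_mul D x y)

theorem crossedEquiv_tmul (b : π.kernel) (v : V) :
    hγ.crossedEquiv D ((hγ.crossedProduct D).tmul b v) = b * γ.hom v := rfl

theorem crossedEquiv_symm {u : U} {n : ℕ} {x : Fin n → U} {v : Fin n → V}
    (h : π.coaction u = ∑ i, x i ⊗ᵇ v i) :
    (hγ.crossedEquiv D).symm u = ∑ i, (hγ.crossedProduct D).tmul (hγ.toKernel D (x i)) (v i) :=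
  hγ.tensorEquiv_symm D h

/-- The `A ⊗ Aᵒᵖ`-ring structure `a ⊗ a' ↦ s(a) # t(a')` of the crossed product. -/
def crossedEnvRing : EnvRing k A (hγ.crossedProduct D).Carrier where
  s := ((hγ.crossedEquiv D).symm : U →ₐ[k] _).comp 𝒰.s
  t := ((hγ.crossedEquiv D).symm : U →ₐ[k] _).comp 𝒰.t
  comm a b := by simp [← map_mul, 𝒰.comm]

theorem crossedEquiv_s (a : A) : hγ.crossedEquiv D ((hγ.crossedEnvRing D).s a) = 𝒰.s a :=
  (hγ.crossedEquiv D).apply_symm_apply _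

theorem crossedEquiv_t (a : Aᵐᵒᵖ) : hγ.crossedEquiv D ((hγ.crossedEnvRing D).t a) = 𝒰.t a :=
  (hγ.crossedEquiv D).apply_symm_apply _

end IsCleaving

end LeftHopfAlgebroid.Hom

end Bialgd

end

/-! ### The crossed product theorem -/

theorem theorem2p8 {k A U V : Type*} [Field k] [CharZero k] [Ring A] [Algebra k A]
    [Ring U] [Algebra k U] [Ring V] [Algebra k V]
    (𝒰 : LeftHopfAlgebroid k A U) (𝒱 : LeftHopfAlgebroid k A V)
    (π : 𝒰.Hom 𝒱) (hπ : Function.Surjective π.hom)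
    (γ : CoringHom 𝒱.toLeftBialgebroid 𝒰.toLeftBialgebroid)
    (hsplit : ∀ v, π.hom (γ.hom v) = v)
    (hproj : 𝒰.WhiteRightProjective)
    (hone : γ.hom 1 = 1)
    (hblack_left : ∀ (a : A) (v : V), γ.hom (v * 𝒱.t (op a)) = γ.hom v * 𝒰.t (op a))
    (hblack_right : ∀ (a : A) (v : V), γ.hom (v * 𝒱.s a) = γ.hom v * 𝒰.s a) :
    ∃ (M : Measuring 𝒱.toLeftBialgebroid π.kernelUnit) (σ : 𝒱.OpTensor →ₗ[k] π.kernel),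
      -- `v ▷ b = γ(v)₊ b γ(v)₋`
      (∀ (v : V) (b : π.kernel) {n : ℕ} (x y : Fin n → U),
        𝒰.translation (γ.hom v) = ∑ i, x i ⊗ᵇ y i →
        (M.act v b : U) = ∑ i, x i * (b : U) * y i) ∧
      -- `σ(v, w) = t(ε(γ(v₍₂₎ w₍₂₎)₊)) γ(v₍₁₎) γ(w₍₁₎) γ(v₍₂₎ w₍₂₎)₋`
      (∀ (v w : V) {n m : ℕ} (x y : Fin n → V) (x' y' : Fin m → V),
        𝒱.comul v = ∑ i, x i ⊗ᵇ y i → 𝒱.comul w = ∑ j, x' j ⊗ᵇ y' j →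
        ∀ c : U, 𝒰.Contracts
          (∑ i, ∑ j, (γ.hom (x i) * γ.hom (x' j)) ⊗ᵇ 𝒰.translation (γ.hom (y i * y' j))) c ↔
          c = σ (v ⊗ᵇ w)) ∧
      IsTwistedModule M σ ∧
      ∃ (C : CrossedProduct M σ) (E : EnvRing k A C.Carrier)
        (δ : C.Carrier →ₗ[k] WTensor E.t 𝒱.s) (Φ : C.Carrier ≃ₐ[k] U),
        -- the `A ⊗ Aᵒᵖ`-ring structure of `B #_σ V`
        (∀ a a' : A, E.s a * E.t (op a') = C.tmul (π.kernelUnit a) (𝒱.t (op a'))) ∧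
        -- the right `V`-comodule algebra structures of `B #_σ V` and `U`
        (∀ (b : π.kernel) (v : V) {n : ℕ} (x y : Fin n → V), 𝒱.comul v = ∑ i, x i ⊗ᵇ y i →
          δ (C.tmul b v) = ∑ i, C.tmul b (x i) ⊗ᵇ y i) ∧
        IsRightComoduleAlgebra 𝒱.toLeftBialgebroid E.t δ ∧
        IsRightComoduleAlgebra 𝒱.toLeftBialgebroid 𝒰.t π.coaction ∧
        -- `Φ` is an isomorphism of `A ⊗ Aᵒᵖ`-rings and of right `V`-comodule algebras
        (∀ (b : π.kernel) (v : V), Φ (C.tmul b v) = (b : U) * γ.hom v) ∧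
        (∀ a, Φ (E.s a) = 𝒰.s a) ∧
        (∀ a, Φ (E.t a) = 𝒰.t a) ∧
        (∀ (r : C.Carrier) {n : ℕ} (x : Fin n → C.Carrier) (y : Fin n → V),
          δ r = ∑ i, x i ⊗ᵇ y i → π.coaction (Φ r) = ∑ i, Φ (x i) ⊗ᵇ y i) ∧
        -- the inverse, `u ↦ t(ε(γ(π(u₍₂₎))₊)) u₍₁₎ γ(π(u₍₂₎))₋ # π(u₍₃₎)`
        ∃ φ : U →ₗ[k] π.kernel,
          (∀ (u : U) {n : ℕ} (x y : Fin n → U), 𝒰.comul u = ∑ i, x i ⊗ᵇ y i →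
            ∀ c : U, 𝒰.Contracts
              (∑ i, x i ⊗ᵇ 𝒰.translation (γ.hom (π.hom (y i)))) c ↔ c = φ u) ∧
          (∀ (u : U) {n : ℕ} (x y : Fin n → U), 𝒰.comul u = ∑ i, x i ⊗ᵇ y i →
            Φ.symm u = ∑ i, C.tmul (φ (x i)) (π.hom (y i))) := by
  -- The maps are built from a chosen dual basis, but the `Contracts` equivalences characterise σ
  -- and φ independently of that choice, and the formula through the translation map does so for the
  -- action.
  obtain ⟨D⟩ := hproj.nonempty_dualBasis
  have hγ : π.IsCleaving γ := ⟨hsplit, hone, hblack_left, hblack_right⟩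
  refine ⟨hγ.measuring D, hγ.cocycle D, ?_, ?_, hγ.isTwistedModule D, hγ.crossedProduct D,
    hγ.crossedEnvRing D,
    transportCoaction (hγ.crossedEquiv D) (hγ.crossedEquiv_t D) 𝒱.s π.coaction,
    hγ.crossedEquiv D, ?_, ?_, ?_, π.isRightComoduleAlgebra_coaction, ?_, hγ.crossedEquiv_s D,
    hγ.crossedEquiv_t D, ?_, hγ.toKernel D, ?_, ?_⟩
  · intro v b n x y h
    rw [hγ.measuring_act, hγ.coe_toKernel, hγ.retraction_section_mul, h, map_sum]
    rfl
  · intro v w n m x y x' y' h h' c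
    rw [hγ.cocycle_tmul, hγ.coe_toKernel]
    refine hγ.contracts_iff D ?_ c
    simp only [hγ.coaction_section_mul_section h h', map_sum,
      LeftHopfAlgebroid.sectionMixed_tmul]
  · intro a a'
    apply (hγ.crossedEquiv D).injective
    -- γ(t(a')) = t(a') γ(1) = t(a'), so both sides have image s(a) t(a') in U.
    have := γ.hom_t (op a') 1
    rw [mul_one, hone, mul_one] at this
    rw [map_mul, hγ.crossedEquiv_s, hγ.crossedEquiv_t, hγ.crossedEquiv_tmul, this,
      π.coe_kernelUnit]
  · intro b v n x y h
    have h1 : π.coaction (hγ.crossedEquiv D ((hγ.crossedProduct D).tmul b v)) =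
        ∑ i, ((b : U) * γ.hom (x i)) ⊗ᵇ y i := by
      rw [hγ.crossedEquiv_tmul, π.coaction_kernel_mul b (hγ.coaction_section h)]
    rw [transportCoaction_eq_sum _ (hγ.crossedEquiv_t D) _ _ h1]
    simp only [← hγ.crossedEquiv_tmul D, AlgEquiv.symm_apply_apply]
  · exact π.isRightComoduleAlgebra_coaction.transport (hγ.crossedEquiv D) (hγ.crossedEquiv_t D)
  · exact fun b v => hγ.crossedEquiv_tmul D b v
  · intro r n x y h
    exact eq_sum_of_transportCoaction _ (hγ.crossedEquiv_t D) _ _ h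
  · intro u n x y h c
    rw [hγ.coe_toKernel]
    refine hγ.contracts_iff D ?_ c
    simp only [π.coaction_eq h, map_sum, LeftHopfAlgebroid.sectionMixed_tmul]
  · intro u n x y h
    exact hγ.crossedEquiv_symm D (π.coaction_eq h)
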